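/- Let $N\ge 2$ and $d\in\mathbb{Z}$. Let $\mathbb{Z}_2$ act on $S^2=\mathbb{C}\cup\infty$ and on $\mathbb{C}\mathrm{P}^N$ by complex conjugation, with base points $\infty\in S^2$ and $[1:1:\cdots:1]\in\mathbb{C}\mathrm{P}^N$. Let $\Omega^2_d\mathbb{C}\mathrm{P}^N$ be the path component of the space of based continuous maps $S^2\to\mathbb{C}\mathrm{P}^N$ (with the compact-open topology) that consists of the maps of degree $d$, and let $(\Omega^2_d\mathbb{C}\mathrm{P}^N)^{\mathbb{Z}_2}\subset\Omega^2_d\mathbb{C}\mathrm{P}^N$ be the subspace of the $\mathbb{Z}_2$-equivariant maps. Then there is a homotopy equivalence $$(\Omega^2_d\mathbb{C}\mathrm{P}^N)^{\mathbb{Z}_2}\simeq \Omega^2S^{2N+1}\times\Omega S^N .$$ In particular, the homotopy type of $(\Omega^2_d\mathbb{C}\mathrm{P}^N)^{\mathbb{Z}_2}$ does not depend on $d$. -/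

import Mathlib

open scoped ComplexConjugate OnePoint Topology.Homotopy

noncomputable section

namespace ConjMaps

/-- The complex projective space `ℂP^N` of lines in `ℂ^(N+1)`. -/
abbrev CP (N : ℕ) : Type := Projectivization ℂ (Fin (N + 1) → ℂ)

/-- `ℂP^N` carries the quotient topology from `ℂ^(N+1) ∖ {0}`. -/
instance instTopologicalSpaceCP (N : ℕ) : TopologicalSpace (CP N) :=
  inferInstanceAs
    (TopologicalSpace (Quotient (projectivizationSetoid ℂ (Fin (N + 1) → ℂ))))

/-- The sphere `S² = ℂ ∪ ∞`, based at `∞`. -/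
abbrev S2 : Type := OnePoint ℂ

/-- The action of the generator of `ℤ₂` on `S² = ℂ ∪ ∞`: complex conjugation, fixing `∞`. -/
def conjS2 : S2 → S2 := OnePoint.map (fun z : ℂ => conj z)

/-- Coordinatewise complex conjugation of `ℂ^(N+1)`, as a conjugate-linear map. -/
def conjVec (N : ℕ) : (Fin (N + 1) → ℂ) →ₛₗ[starRingEnd ℂ] (Fin (N + 1) → ℂ) where
  toFun v i := conj (v i)
  map_add' v w := by ext i; simp
  map_smul' c v := by ext i; simp

theorem conjVec_injective (N : ℕ) : Function.Injective (conjVec N) := by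
  intro v w h
  ext i
  exact (starRingEnd ℂ).injective (congrFun h i)

/-- The action of the generator of `ℤ₂` on `ℂP^N`:
`[z₀ : … : z_N] ↦ [conj z₀ : … : conj z_N]`. -/
def conjCP (N : ℕ) : CP N → CP N := Projectivization.map (conjVec N) (conjVec_injective N)

theorem ones_ne_zero (N : ℕ) : (fun _ => 1 : Fin (N + 1) → ℂ) ≠ 0 :=
  fun h => one_ne_zero (congrFun h 0)

/-- The base point `[1 : 1 : … : 1]` of `ℂP^N`. -/
def baseCP (N : ℕ) : CP N := Projectivization.mk ℂ (fun _ => 1) (ones_ne_zero N)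

/-- `Ω²ℂP^N = Map^*(S², ℂP^N)`: the based maps `(S², ∞) → (ℂP^N, [1 : … : 1])`, with the
compact-open topology. -/
abbrev BasedMap (N : ℕ) : Type := {f : C(S2, CP N) // f ∞ = baseCP N}

theorem continuous_onePoint_map_pow (n : ℕ) :
    Continuous (OnePoint.map (fun z : ℂ => z ^ (n + 1))) := by
  refine OnePoint.continuous_map (by fun_prop) ?_
  rw [Filter.coclosedCompact_eq_cocompact]
  refine tendsto_norm_atTop_iff_cobounded.mp ?_ |>.mono_right
    (Metric.cobounded_eq_cocompact (α := ℂ)).le |>.mono_left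
    (Metric.cobounded_eq_cocompact (α := ℂ)).ge
  simp only [norm_pow]
  exact (Filter.tendsto_pow_atTop (Nat.succ_ne_zero n)).comp tendsto_norm_cobounded_atTop

theorem continuous_onePoint_map_conj_pow (n : ℕ) :
    Continuous (OnePoint.map (fun z : ℂ => conj z ^ (n + 1))) := by
  refine OnePoint.continuous_map (by fun_prop) ?_
  rw [Filter.coclosedCompact_eq_cocompact]
  refine tendsto_norm_atTop_iff_cobounded.mp ?_ |>.mono_right
    (Metric.cobounded_eq_cocompact (α := ℂ)).le |>.mono_left
    (Metric.cobounded_eq_cocompact (α := ℂ)).ge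
  simp only [norm_pow, RCLike.norm_conj]
  exact (Filter.tendsto_pow_atTop (Nat.succ_ne_zero n)).comp tendsto_norm_cobounded_atTop

/-- The standard based self-map of `S² = ℂ ∪ ∞` of degree `d`: `z ↦ z ^ d` for `d > 0`,
`z ↦ (conj z) ^ |d|` for `d < 0`, and the constant map to `∞` for `d = 0`. -/
def powerMap : ℤ → C(S2, S2)
  | Int.ofNat 0 => ContinuousMap.const S2 ∞
  | Int.ofNat (n + 1) => ⟨_, continuous_onePoint_map_pow n⟩
  | Int.negSucc n => ⟨_, continuous_onePoint_map_conj_pow n⟩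

/-- The vector `(z + 1, z, …, z)` of `ℂ^(N+1)`. -/
def lineVec (N : ℕ) (z : ℂ) : Fin (N + 1) → ℂ := fun i => if i = 0 then z + 1 else z

theorem lineVec_ne_zero {N : ℕ} (hN : 1 ≤ N) (z : ℂ) : lineVec N z ≠ 0 := by
  intro h
  have h0 : z + 1 = 0 := by simpa [lineVec] using congrFun h 0
  have h1 : z = 0 := by
    have := congrFun h (Fin.last N)
    rwa [lineVec, if_neg (by simp [Fin.ext_iff]; omega)] at this
  simp [h1] at h0

theorem continuous_mk {N : ℕ} {X : Type*} [TopologicalSpace X] (v : X → Fin (N + 1) → ℂ)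
    (hv : ∀ x, v x ≠ 0) (hc : Continuous v) :
    Continuous fun x => (Projectivization.mk ℂ (v x) (hv x) : CP N) :=
  continuous_quotient_mk'.comp (hc.subtype_mk hv)

theorem tendsto_line {N : ℕ} (hN : 1 ≤ N) :
    Filter.Tendsto (fun z : ℂ => (Projectivization.mk ℂ (lineVec N z) (lineVec_ne_zero hN z) : CP N))
      (Filter.coclosedCompact ℂ) (nhds (baseCP N)) := by
  -- in the coordinate `w = 1 / z` the map reads `[1 + w : 1 : … : 1]`
  have hne : ∀ w : ℂ, (fun i : Fin (N + 1) => if i = 0 then 1 + w else 1) ≠ (0 : Fin (N + 1) → ℂ) := by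
    intro w h
    have := congrFun h (Fin.last N)
    rw [if_neg (by simp [Fin.ext_iff]; omega)] at this
    exact one_ne_zero this
  have hc : Continuous fun w : ℂ => (Projectivization.mk ℂ _ (hne w) : CP N) := by
    refine continuous_mk _ hne (continuous_pi fun i => ?_)
    split_ifs <;> fun_prop
  have h0 : (Projectivization.mk ℂ _ (hne 0) : CP N) = baseCP N := by
    simp [baseCP]
  rw [Filter.coclosedCompact_eq_cocompact, ← Metric.cobounded_eq_cocompact, ← h0]
  refine ((hc.tendsto 0).comp (Filter.tendsto_inv₀_cobounded (α := ℂ))).congr' ?_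
  filter_upwards [Bornology.eventually_ne_cobounded (0 : ℂ)] with z hz
  refine (Projectivization.mk_eq_mk_iff' ℂ _ _ _ _).mpr ⟨z⁻¹, ?_⟩
  ext i
  by_cases hi : i = 0 <;> simp [lineVec, hi, hz, mul_add]

/-- The based inclusion of the projective line `S² = ℂP¹ ⊂ ℂP^N`, `N ≥ 1`, given by
`z ↦ [z + 1 : z : … : z]` and `∞ ↦ [1 : 1 : … : 1]`. -/
def lineMap {N : ℕ} (hN : 1 ≤ N) : C(S2, CP N) :=
  OnePoint.continuousMapMk
    ⟨fun z => Projectivization.mk ℂ (lineVec N z) (lineVec_ne_zero hN z),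
      continuous_mk _ _ (continuous_pi fun i => by unfold lineVec; split_ifs <;> fun_prop)⟩
    (baseCP N) (tendsto_line hN)

theorem powerMap_infty (d : ℤ) : powerMap d ∞ = ∞ := by
  rcases d with (_ | n) | n <;> rfl

/-- The standard based map `S² → ℂP^N` of degree `d`: the degree `d` self-map of `S²` followed by
the inclusion of the projective line. -/
def standardMap {N : ℕ} (hN : 1 ≤ N) (d : ℤ) : BasedMap N :=
  ⟨(lineMap hN).comp (powerMap d), by
    rw [ContinuousMap.comp_apply, powerMap_infty]; rfl⟩

/-- `Ω²_d ℂP^N`: the path component of `Ω²ℂP^N` that corresponds to `d` under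
`π₀(Ω²ℂP^N) = ℤ`, that is, the path component of the standard map of degree `d`. -/
def degreeComponent {N : ℕ} (hN : 1 ≤ N) (d : ℤ) : Set (BasedMap N) :=
  pathComponent (standardMap hN d)

/-- `(Ω²_d ℂP^N)^{ℤ₂}`: the subspace of `Ω²_d ℂP^N` of all maps that are equivariant with respect
to complex conjugation. -/
abbrev EquivariantMaps {N : ℕ} (hN : 1 ≤ N) (d : ℤ) : Type :=
  {f : BasedMap N // f ∈ degreeComponent hN d ∧ ∀ x : S2, f.1 (conjS2 x) = conjCP N (f.1 x)}

/-- The unit sphere `S^n` in `ℝ^(n+1)`. -/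
abbrev Sph (n : ℕ) : Type := Metric.sphere (0 : EuclideanSpace ℝ (Fin (n + 1))) 1

end ConjMaps

end

/-! An equivariant map is determined by its restriction to the closed upper half plane with `∞`, and
the only condition there is that the real axis goes to `ℝP^N`. This half plane is a square with
three sides collapsed to `∞`. Transporting the base vector up the vertical lines lifts the
restriction to `S^(2N+1)`. The lift is a path of loops on `S^(2N+1)` from the constant loop to a
loop lying over `ℝP^N`. Projecting back to `ℂP^N` recovers the map, and two lifts differ only by a
deformable phase. So the equivariant maps are, up to homotopy, the homotopy fibre of the inclusion
of the loops over `ℝP^N` into `ΩS^(2N+1)` (`exists_homotopyInverse_equivariantLift`).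

A loop over `ℝP^N` has the form `exp(iθ/2) r` with `r` a path of real unit vectors and `θ` running
from `0` to `2πk`. Straightening the phase `θ` leaves the paths in `S^N` from the base point `b` to
`(-1)^k b` (`realLoopsWithHomotopyEquiv`). As `S^N` is path connected, these form a copy of `ΩS^N`
whatever the parity of `k`. An explicit homotopy contracts the loops of winding number `k` inside
`ΩS^(2N+1)` (`homotopic_realLoopsWith`). The homotopy fibre of a null-homotopic inclusion splits as
a product (`nonempty_pathsInto_homotopyEquiv`), which gives `ΩS^N × Ω²S^(2N+1)`.

It remains to match path components of `Ω²ℂP^N` with winding numbers. The winding number extends to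
a continuous integer function on all based maps (`exists_degree`), so it is constant on each
component. Conversely, for `N ≥ 2` the product above is path connected, so equivariant maps of equal
winding number are joined. The degree of the standard map need not be computed, only its
equivariance matters. -/

open scoped unitInterval ContinuousMap Topology InnerProductSpace

noncomputable section

namespace ConjMaps

/-! ### Spaces of paths with prescribed start and with end in a given set -/

section Paths

variable {A X Y : Type*} [TopologicalSpace A] [TopologicalSpace X] [TopologicalSpace Y]

/-- The space of paths in `X` that start at `c` and end in `B`: the homotopy fibre over `c` of the
inclusion of `B`. -/
abbrev PathsInto (c : X) (B : Set X) : Type _ := {γ : C(I, X) // γ 0 = c ∧ γ 1 ∈ B}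

/-- A homotopy of continuous maps, given by a jointly continuous function. -/
theorem homotopic_of_continuous {f g : C(A, Y)} (H : I → A → Y)
    (hH : Continuous fun p : I × A => H p.1 p.2) (h0 : ∀ a, H 0 a = f a) (h1 : ∀ a, H 1 a = g a) :
    f.Homotopic g :=
  ⟨⟨⟨fun p => H p.1 p.2, hH⟩, h0, h1⟩⟩

/-- The point `s` of the real line clamped to the unit interval. -/
abbrev clamp (s : ℝ) : I := Set.projIcc 0 1 zero_le_one s

theorem continuous_clamp : Continuous clamp := continuous_projIcc

@[fun_prop]
theorem continuous_clamp_comp {f : A → ℝ} (hf : Continuous f) : Continuous fun a => clamp (f a) :=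
  continuous_clamp.comp hf

theorem clamp_of_nonpos {s : ℝ} (h : s ≤ 0) : clamp s = 0 := Set.projIcc_of_le_left _ h

theorem clamp_of_one_le {s : ℝ} (h : 1 ≤ s) : clamp s = 1 := Set.projIcc_of_right_le _ h

@[simp]
theorem clamp_coe (s : I) : clamp (s : ℝ) = s := Set.projIcc_val _ s

theorem coe_clamp (s : ℝ) : (clamp s : ℝ) = max 0 (min 1 s) := rfl

theorem continuous_into_continuousMap {K : Type*} [TopologicalSpace K] {f : A → C(K, X)}
    (h : Continuous fun p : A × K => f p.1 p.2) : Continuous f :=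
  ContinuousMap.continuous_of_continuous_uncurry f h

theorem continuous_family_apply (γ : C(A, C(I, X))) {B : Type*} [TopologicalSpace B] {f : B → A}
    {g : B → I} (hf : Continuous f) (hg : Continuous g) : Continuous fun b => γ (f b) (g b) :=
  (γ.continuous.comp hf).eval hg

/-- Concatenation of two families of paths. -/
def catFamily (γ δ : C(A, C(I, X))) (h : ∀ a, γ a 1 = δ a 0) : C(A, C(I, X)) :=
  ContinuousMap.curry
    ⟨fun p : A × I => if (p.2 : ℝ) ≤ 1 / 2 then γ p.1 (clamp (2 * p.2))
        else δ p.1 (clamp (2 * p.2 - 1)), by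
      refine Continuous.if_le ?_ ?_ (by fun_prop) (by fun_prop) ?_
      · exact continuous_family_apply γ (by fun_prop) (by fun_prop)
      · exact continuous_family_apply δ (by fun_prop) (by fun_prop)
      · intro p hp
        rw [clamp_of_one_le (by linarith), clamp_of_nonpos (by linarith), h]⟩

theorem catFamily_apply (γ δ : C(A, C(I, X))) (h : ∀ a, γ a 1 = δ a 0) (a : A) (t : I) :
    catFamily γ δ h a t = if (t : ℝ) ≤ 1 / 2 then γ a (clamp (2 * t))
        else δ a (clamp (2 * t - 1)) := rfl

@[simp]
theorem catFamily_zero (γ δ : C(A, C(I, X))) (h : ∀ a, γ a 1 = δ a 0) (a : A) :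
    catFamily γ δ h a 0 = γ a 0 := by
  rw [catFamily_apply, if_pos (by simp), clamp_of_nonpos (by simp)]

@[simp]
theorem catFamily_one (γ δ : C(A, C(I, X))) (h : ∀ a, γ a 1 = δ a 0) (a : A) :
    catFamily γ δ h a 1 = δ a 1 := by
  rw [catFamily_apply, if_neg (by norm_num), clamp_of_one_le (by norm_num)]

/-- The family of reversed paths. -/
def revFamily (γ : C(A, C(I, X))) : C(A, C(I, X)) :=
  ContinuousMap.curry
    ⟨fun p : A × I => γ p.1 (σ p.2), continuous_family_apply γ (by fun_prop) (by fun_prop)⟩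

@[simp]
theorem revFamily_apply (γ : C(A, C(I, X))) (a : A) (t : I) : revFamily γ a t = γ a (σ t) := rfl

/-- Going along `p` and back is homotopic to staying, in families and relative to the ends. -/
theorem exists_cancel (γ p : C(A, C(I, X))) (h : ∀ a, γ a 1 = p a 0) :
    ∃ K : I → A → C(I, X), Continuous (fun q : I × A => K q.1 q.2) ∧
      (∀ a, K 0 a = catFamily (catFamily γ p h) (revFamily p) (by simp) a) ∧
      (∀ a t, K 1 a t = γ a (clamp (4 * t))) ∧
      (∀ s a, K s a 0 = γ a 0) ∧ ∀ s a, K s a 1 = γ a 1 := by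
  let γ' : C(I × A, C(I, X)) := ⟨fun q => γ q.2, by fun_prop⟩
  -- At stage `s` only the part of `p` up to parameter `1 - s` is walked and then retraced. At `s =
  -- 1` what remains is `γ`, run in the first quarter of the time, hence the factor `4` in the third
  -- clause.
  let p' : C(I × A, C(I, X)) := ContinuousMap.curry
    ⟨fun q : (I × A) × I => p q.1.2 (σ q.1.1 * q.2),
      continuous_family_apply p (by fun_prop) (by fun_prop)⟩
  have hp' : ∀ s a t, p' (s, a) t = p a (σ s * t) := fun s a t => rfl
  have hγ' : ∀ s a, γ' (s, a) = γ a := fun s a => rfl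
  have h' : ∀ q, γ' q 1 = p' q 0 := by
    rintro ⟨s, a⟩
    rw [hp', hγ', mul_zero, h]
  refine ⟨fun s a => catFamily (catFamily γ' p' h') (revFamily p') (by simp) (s, a), ?_, ?_, ?_,
    ?_, ?_⟩
  · exact (map_continuous _).comp (by fun_prop)
  · intro a
    ext t
    simp only [catFamily_apply, hγ', hp', revFamily_apply, unitInterval.symm_zero, one_mul]
  · intro a t
    simp only [catFamily_apply, hγ', hp', revFamily_apply, unitInterval.symm_one, zero_mul, ← h]
    have ht := t.2
    split_ifs with h1 h2
    · rw [coe_clamp, max_eq_right (by simpa using ht.1), min_eq_right (by linarith)]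
      congr 2
      ring
    · rw [coe_clamp, max_eq_right (by simpa using ht.1), min_eq_right (by linarith)] at h2
      rw [clamp_of_one_le (by linarith)]
    · rw [clamp_of_one_le (by linarith)]
  · simp [hγ']
  · intro s a
    simp [hp', h]

/-- Fast reparametrisation is homotopic to the identity. -/
theorem exists_reparam (γ : C(A, C(I, X))) :
    ∃ K : I → A → C(I, X), Continuous (fun q : I × A => K q.1 q.2) ∧
      (∀ a t, K 0 a t = γ a (clamp (4 * t))) ∧ (∀ a, K 1 a = γ a) ∧
      (∀ s a, K s a 0 = γ a 0) ∧ ∀ s a, K s a 1 = γ a 1 := by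
  let K : C(I × A, C(I, X)) := ContinuousMap.curry
    ⟨fun q : (I × A) × I => γ q.1.2 (clamp ((4 - 3 * (q.1.1 : ℝ)) * q.2)),
      continuous_family_apply γ (by fun_prop) (by fun_prop)⟩
  have hK : ∀ s a t, K (s, a) t = γ a (clamp ((4 - 3 * (s : ℝ)) * t)) := fun _ _ _ => rfl
  refine ⟨fun s a => K (s, a), K.continuous, ?_, ?_, ?_, ?_⟩
  · intro a t
    simp [hK]
  · intro a
    ext t
    rw [hK]
    norm_num
  · intro s a
    rw [hK, clamp_of_nonpos (by simp)]
  · intro s a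
    rw [hK, clamp_of_one_le]
    have := s.2.2
    simp only [Set.Icc.coe_one]
    linarith

/-- If the inclusion of `B` is homotopic to a constant map then the homotopy fibre of the inclusion
is the product of `B` with the homotopy fibre over the constant. -/
theorem nonempty_pathsInto_homotopyEquiv (c : X) (B : Set X) (b₀ : X)
    (hB : ContinuousMap.Homotopic (⟨Subtype.val, continuous_subtype_val⟩ : C(B, X))
      (ContinuousMap.const B b₀)) :
    Nonempty (PathsInto c B ≃ₕ B × PathsInto c {b₀}) := by
  obtain ⟨F⟩ := hB
  -- The track of `b` under the null-homotopy runs from `b` to `b₀`. Appending it, or its reverse,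
  -- to a path gives the two inverse maps; the end point `b` must be remembered as the extra factor.
  let P : C(B, C(I, X)) := ContinuousMap.curry ⟨fun q : B × I => F (q.2, q.1), by fun_prop⟩
  have hP0 : ∀ b, P b 0 = b := fun b => F.apply_zero b
  have hP1 : ∀ b, P b 1 = b₀ := fun b => F.apply_one b
  let val : C(PathsInto c B, C(I, X)) := ⟨Subtype.val, continuous_subtype_val⟩
  let fin : C(PathsInto c B, B) := ⟨fun γ => ⟨γ.1 1, γ.2.2⟩, by fun_prop⟩
  let val' : C(B × PathsInto c {b₀}, C(I, X)) := ⟨fun q => q.2.1, by fun_prop⟩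
  let fin' : C(B × PathsInto c {b₀}, B) := ⟨Prod.fst, by fun_prop⟩
  have hv : ∀ γ, val γ = γ.1 := fun _ => rfl
  have hv' : ∀ q, val' q = q.2.1 := fun _ => rfl
  have hf : ∀ γ, (fin γ : X) = γ.1 1 := fun _ => rfl
  have hf' : ∀ q, fin' q = q.1 := fun _ => rfl
  let cf := catFamily val (P.comp fin) (fun γ => by simp [hP0, hv, hf])
  let cb := catFamily val' (revFamily (P.comp fin')) (fun q => by
    simpa [hP1, hv', hf'] using q.2.2.2)
  let f : C(PathsInto c B, B × PathsInto c {b₀}) :=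
    ⟨fun γ => (fin γ, ⟨cf γ, by simp [cf, hv, hP1, γ.2.1]⟩), by fun_prop⟩
  let g : C(B × PathsInto c {b₀}, PathsInto c B) :=
    ⟨fun q => ⟨cb q, by simp [cb, hv', hP0, hf', q.2.2.1]⟩, by fun_prop⟩
  have hg1 : ∀ q, (g q).1 1 = q.1 := fun q => by
    change cb q 1 = q.1
    simp [cb, hP0, hf']
  refine ⟨⟨f, g, ?_, ?_⟩⟩
  · obtain ⟨K, hK, hK0, hK1, hKz, hKo⟩ := exists_cancel val (P.comp fin)
      (fun γ => by simp [hP0, hv, hf])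
    obtain ⟨K', hK', hK0', hK1', hKz', hKo'⟩ := exists_reparam val
    -- The intermediate stage: `γ` run at fourfold speed, after cancelling the detour and before
    -- reparametrising.
    let M : C(PathsInto c B, PathsInto c B) :=
      ⟨fun γ => ⟨K 1 γ, by rw [hKz, hKo]; exact γ.2⟩,
        Continuous.subtype_mk (f := K 1)
          (hK.comp (by fun_prop : Continuous fun γ => ((1 : I), γ)))
          fun γ => by rw [hKz, hKo]; exact γ.2⟩
    refine ContinuousMap.Homotopic.trans (g := M) ?_ ?_
    · refine homotopic_of_continuous (fun s γ => ⟨K s γ, by rw [hKz, hKo]; exact γ.2⟩)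
        (hK.subtype_mk _) ?_ fun γ => rfl
      intro γ
      refine Subtype.ext ?_
      change K 0 γ = cb (f γ)
      rw [hK0]
      rfl
    · refine homotopic_of_continuous (fun s γ => ⟨K' s γ, by rw [hKz', hKo']; exact γ.2⟩)
        (hK'.subtype_mk _) ?_ fun γ => ?_
      · intro γ
        refine Subtype.ext ?_
        ext t
        change K' 0 γ t = K 1 γ t
        rw [hK0', hK1]
      · exact Subtype.ext (hK1' γ)
  · obtain ⟨K, hK, hK0, hK1, hKz, hKo⟩ := exists_cancel val' (revFamily (P.comp fin'))
      (fun q => by simpa [hP1, hv', hf'] using q.2.2.2)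
    obtain ⟨K', hK', hK0', hK1', hKz', hKo'⟩ := exists_reparam val'
    let M : C(B × PathsInto c {b₀}, B × PathsInto c {b₀}) :=
      ⟨fun q => (q.1, ⟨K 1 q, by rw [hKz, hKo]; exact q.2.2⟩),
        continuous_fst.prodMk
          (Continuous.subtype_mk (f := K 1)
            (hK.comp (by fun_prop : Continuous fun q => ((1 : I), q)))
            fun q => by rw [hKz, hKo]; exact q.2.2)⟩
    refine ContinuousMap.Homotopic.trans (g := M) ?_ ?_
    · refine homotopic_of_continuous
        (fun s q => (q.1, ⟨K s q, by rw [hKz, hKo]; exact q.2.2⟩))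
        ((continuous_fst.comp continuous_snd).prodMk (hK.subtype_mk _)) ?_ fun q => rfl
      intro q
      refine Prod.ext (Subtype.ext (hg1 q).symm) (Subtype.ext ?_)
      change K 0 q = cf (g q)
      rw [hK0]
      ext t
      have hfg : fin (g q) = q.1 := Subtype.ext (hg1 q)
      simp only [cf, catFamily_apply, revFamily_apply, ContinuousMap.comp_apply, hfg, hf',
        unitInterval.symm_symm]
      rfl
    · refine homotopic_of_continuous
        (fun s q => (q.1, ⟨K' s q, by rw [hKz', hKo']; exact q.2.2⟩))
        ((continuous_fst.comp continuous_snd).prodMk (hK'.subtype_mk _)) ?_ fun q => ?_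
      · intro q
        refine Prod.ext rfl (Subtype.ext ?_)
        ext t
        change K' 0 q t = K 1 q t
        rw [hK0', hK1]
      · exact Prod.ext rfl (Subtype.ext (hK1' q))

/-- Changing the end point along a path does not change the homotopy type. -/
theorem nonempty_pathsInto_singleton_homotopyEquiv (c : X) {b b₀ : X} (h : Joined b b₀) :
    Nonempty (PathsInto c {b} ≃ₕ PathsInto c {b₀}) := by
  obtain ⟨p⟩ := h
  -- The inclusion of the single point `b` moves along the path to the constant `b₀`; the one-point
  -- factor is then dropped.
  obtain ⟨e⟩ := nonempty_pathsInto_homotopyEquiv c {b} b₀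
    (homotopic_of_continuous (fun s _ => p s) (by fun_prop)
      (fun a => by rw [p.source]; exact a.2.symm) (fun a => by simp))
  exact ⟨e.trans (Homeomorph.uniqueProd _ _).toHomotopyEquiv⟩

/-- The loop space as a space of paths. -/
def pathHomeomorph (x y : X) : Path x y ≃ₜ PathsInto x {y} where
  toFun p := ⟨p.toContinuousMap, p.source, p.target⟩
  invFun γ := ⟨γ.1, γ.2.1, γ.2.2⟩
  left_inv p := by ext; rfl
  right_inv γ := rfl
  continuous_toFun := continuous_induced_dom.subtype_mk _
  continuous_invFun := continuous_induced_rng.mpr continuous_subtype_val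

/-- Homeomorphic spaces have homeomorphic path spaces. -/
def pathsIntoCongr (φ : X ≃ₜ Y) (c : X) (b : X) :
    PathsInto c {b} ≃ₜ PathsInto (φ c) {φ b} where
  toFun γ := ⟨(φ : C(X, Y)).comp γ.1, congrArg φ γ.2.1, congrArg φ γ.2.2⟩
  invFun γ := ⟨(φ.symm : C(Y, X)).comp γ.1, by simp [γ.2.1], by simpa using congrArg φ.symm γ.2.2⟩
  left_inv γ := by ext; simp
  right_inv γ := by ext; simp
  continuous_toFun := by fun_prop
  continuous_invFun := by fun_prop

/-- The constant loop. -/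
def constLoop (x : X) : PathsInto x {x} := ⟨ContinuousMap.const I x, rfl, rfl⟩

/-- The double loop space as an iterated space of paths. -/
def genLoopTwoHomeomorph (x : X) :
    Ω^ (Fin 2) X x ≃ₜ PathsInto (constLoop x) {constLoop x} where
  toFun p := ⟨⟨fun t => ⟨⟨fun s => p ![s, t], by fun_prop⟩,
      p.2 _ ⟨0, Or.inl rfl⟩, p.2 _ ⟨0, Or.inr rfl⟩⟩,
      (continuous_into_continuousMap (by
        change Continuous fun q : I × I => p ![q.2, q.1]
        fun_prop)).subtype_mk _⟩,
    Subtype.ext (ContinuousMap.ext fun s => p.2 _ ⟨1, Or.inl rfl⟩),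
    Subtype.ext (ContinuousMap.ext fun s => p.2 _ ⟨1, Or.inr rfl⟩)⟩
  invFun γ := ⟨⟨fun y => (γ.1 (y 1)).1 (y 0), by fun_prop⟩, by
    rintro y ⟨i, hi⟩
    change (γ.1 (y 1)).1 (y 0) = x
    fin_cases i
    · change y 0 = 0 ∨ y 0 = 1 at hi
      rcases hi with hi | hi <;> rw [hi]
      exacts [(γ.1 _).2.1, (γ.1 _).2.2]
    · change y 1 = 0 ∨ y 1 = 1 at hi
      rcases hi with hi | hi <;> rw [hi]
      · rw [γ.2.1]; rfl
      · rw [show γ.1 1 = constLoop x from γ.2.2]; rfl⟩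
  left_inv p := by
    ext y
    change p ![y 0, y 1] = p y
    congr 1
    ext i
    fin_cases i <;> rfl
  right_inv γ := rfl
  continuous_toFun := by
    refine Continuous.subtype_mk (continuous_into_continuousMap (Continuous.subtype_mk
      (continuous_into_continuousMap ?_) _)) _
    change Continuous fun q : (Ω^ (Fin 2) X x × I) × I => q.1.1 ![q.2, q.1.2]
    fun_prop
  continuous_invFun := by
    refine Continuous.subtype_mk (continuous_into_continuousMap ?_) _
    change Continuous fun q : PathsInto (constLoop x) {constLoop x} × (Fin 2 → I) =>
      (q.1.1 (q.2 1)).1 (q.2 0)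
    fun_prop

/-- A homotopy equivalence restricts to the fibres of a continuous function with discrete values. -/
theorem nonempty_homotopyEquiv_fiber {D : Type*} [TopologicalSpace D] [DiscreteTopology D]
    (f : C(X, Y)) (g : C(Y, X)) (hgf : ∀ x, g (f x) = x)
    (H : (f.comp g).Homotopic (ContinuousMap.id Y)) (w : C(Y, D)) (k : D) :
    Nonempty ({x // w (f x) = k} ≃ₕ {y // w y = k}) := by
  obtain ⟨H⟩ := H
  -- A discrete-valued function is constant along the homotopy, so the homotopy stays inside each
  -- fibre.
  have hw : ∀ s y, w (H (s, y)) = w y := by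
    intro s y
    have h1 : w (H (1, y)) = w y := by rw [H.apply_one]; rfl
    rw [← h1]
    exact PreconnectedSpace.constant (α := I) (f := fun s => w (H (s, y))) inferInstance
      (by fun_prop)
  have hw' : ∀ y, w (f (g y)) = w y := fun y => by
    have := hw 0 y
    rwa [H.apply_zero] at this
  refine ⟨⟨⟨fun x => ⟨f x.1, x.2⟩, by fun_prop⟩, ⟨fun y => ⟨g y.1, (hw' _).trans y.2⟩, by fun_prop⟩,
    ?_, ?_⟩⟩
  · convert ContinuousMap.Homotopic.refl _
    ext x
    exact (hgf x.1).symm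
  · refine homotopic_of_continuous (fun s y => ⟨H (s, y.1), (hw s _).trans y.2⟩)
      (Continuous.subtype_mk (by fun_prop) _) ?_ ?_
    · intro y
      exact Subtype.ext (H.apply_zero _)
    · intro y
      exact Subtype.ext (H.apply_one _)

end Paths

/-! ### The closed upper half plane as a quotient of the square -/

section Conjugation

variable {N : ℕ}

theorem continuous_conjS2 : Continuous conjS2 := by
  simpa [conjS2] using continuous_onePoint_map_conj_pow 0

@[simp]
theorem conjS2_infty : conjS2 ∞ = ∞ := rfl

@[simp]
theorem conjS2_coe (z : ℂ) : conjS2 (z : S2) = ((conj z : ℂ) : S2) := rfl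

@[simp]
theorem conjS2_conjS2 (w : S2) : conjS2 (conjS2 w) = w := by
  induction w using OnePoint.rec <;> simp

theorem conjVec_ne_zero {v : Fin (N + 1) → ℂ} (hv : v ≠ 0) : conjVec N v ≠ 0 := fun h =>
  hv (conjVec_injective N (h.trans (map_zero (conjVec N)).symm))

theorem conjCP_mk (v : Fin (N + 1) → ℂ) (hv : v ≠ 0) :
    conjCP N (Projectivization.mk ℂ v hv) =
      Projectivization.mk ℂ (conjVec N v) (conjVec_ne_zero hv) := rfl

theorem conjVec_apply (v : Fin (N + 1) → ℂ) (i : Fin (N + 1)) : conjVec N v i = conj (v i) := rfl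

@[simp]
theorem conjVec_conjVec (v : Fin (N + 1) → ℂ) : conjVec N (conjVec N v) = v := by
  ext i
  simp [conjVec_apply]

@[simp]
theorem conjCP_conjCP (x : CP N) : conjCP N (conjCP N x) = x := by
  induction x using Projectivization.ind with
  | h v hv => simp [conjCP_mk]

@[simp]
theorem conjCP_baseCP : conjCP N (baseCP N) = baseCP N := by
  simp only [baseCP, conjCP_mk]
  congr 1
  ext i
  simp [conjVec_apply]

theorem continuous_conjVec : Continuous (conjVec N) :=
  continuous_pi fun i => Complex.continuous_conj.comp (continuous_apply i)

theorem continuous_conjCP : Continuous (conjCP N) := by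
  refine continuous_quot_lift _ ?_
  exact continuous_mk (fun v : {v : Fin (N + 1) → ℂ // v ≠ 0} => conjVec N v.1)
    (fun v => conjVec_ne_zero v.2)
    (continuous_conjVec.comp continuous_subtype_val)

end Conjugation

/-- The distance-like function that vanishes exactly on the three sides `x = 0`, `x = 1`, `t = 0`
of the square. -/
def sideFun (p : I × I) : ℝ := min ((p.1 : ℝ) * (1 - p.1)) p.2

theorem continuous_sideFun : Continuous sideFun := by unfold sideFun; fun_prop

theorem sideFun_nonneg (p : I × I) : 0 ≤ sideFun p :=
  le_min (mul_nonneg p.1.2.1 (by linarith [p.1.2.2])) p.2.2.1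

theorem sideFun_eq_zero_iff (p : I × I) : sideFun p = 0 ↔ p.1 = 0 ∨ p.1 = 1 ∨ p.2 = 0 := by
  obtain ⟨⟨x, hx0, hx1⟩, ⟨t, ht0, ht1⟩⟩ := p
  simp only [sideFun, Subtype.ext_iff, Set.Icc.coe_zero, Set.Icc.coe_one]
  have hnn : 0 ≤ x * (1 - x) := mul_nonneg hx0 (by linarith)
  constructor
  · intro h
    rcases min_choice (x * (1 - x)) t with h' | h' <;> rw [h'] at h
    · rcases mul_eq_zero.mp h with h | h
      · exact Or.inl h
      · exact Or.inr (Or.inl (by linarith))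
    · exact Or.inr (Or.inr h)
  · rintro (rfl | rfl | rfl)
    · simpa using ht0
    · simpa using ht0
    · simpa using hnn

/-- The coordinates of the point of the upper half plane that corresponds to a point of the
square. -/
def halfCoord (p : I × I) : ℂ := ⟨(1 - (p.1 : ℝ))⁻¹ - (p.1 : ℝ)⁻¹, (p.2 : ℝ)⁻¹ - 1⟩

theorem pos_of_sideFun_ne_zero {p : I × I} (h : sideFun p ≠ 0) :
    0 < (p.1 : ℝ) ∧ (p.1 : ℝ) < 1 ∧ 0 < (p.2 : ℝ) := by
  rw [Ne, sideFun_eq_zero_iff] at h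
  push Not at h
  exact ⟨unitInterval.pos_iff_ne_zero.mpr h.1, unitInterval.lt_one_iff_ne_one.mpr h.2.1,
    unitInterval.pos_iff_ne_zero.mpr h.2.2⟩

/-- Quantitative properness, used for continuity of `halfMap` over `∞`. The constant comes from
`(1-x)⁻¹ - x⁻¹ = (2x-1)/(x(1-x))` together with `1 - 4x(1-x) = (2x-1)² ≤ |2x-1|`; the vertical
coordinate would only need `1`. -/
theorem inv_sideFun_le (p : I × I) (h : sideFun p ≠ 0) : (sideFun p)⁻¹ ≤ ‖halfCoord p‖ + 4 := by
  obtain ⟨hx0, hx1, ht⟩ := pos_of_sideFun_ne_zero h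
  have hre := Complex.abs_re_le_norm (halfCoord p)
  have him := Complex.abs_im_le_norm (halfCoord p)
  simp only [halfCoord] at hre him ⊢
  unfold sideFun at h ⊢
  generalize (p.1 : ℝ) = x at *
  generalize (p.2 : ℝ) = t at *
  rcases min_choice (x * (1 - x)) t with h' | h' <;> rw [h']
  · refine le_trans ?_ (add_le_add_left hre 4)
    have hy : 0 < 1 - x := by linarith
    have e : (1 - x)⁻¹ - x⁻¹ = (2 * x - 1) * (x * (1 - x))⁻¹ := by field_simp; ring
    have hp : 0 < (x * (1 - x))⁻¹ := by positivity
    have e1 : (1 - 4 * (x * (1 - x))) * (x * (1 - x))⁻¹ = (x * (1 - x))⁻¹ - 4 := by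
      field_simp
    have h2 : 1 - 4 * (x * (1 - x)) ≤ |2 * x - 1| := by
      have : |2 * x - 1| ≤ 1 := abs_le.mpr ⟨by linarith, by linarith⟩
      nlinarith [abs_nonneg (2 * x - 1), sq_abs (2 * x - 1)]
    rw [e, abs_mul, abs_of_pos hp]
    nlinarith [mul_le_mul_of_nonneg_right h2 hp.le]
  · refine le_trans ?_ (add_le_add_left him 4)
    linarith [le_abs_self (t⁻¹ - 1)]

theorem continuousAt_halfCoord {p : I × I} (h : sideFun p ≠ 0) : ContinuousAt halfCoord p := by
  obtain ⟨hx0, hx1, ht⟩ := pos_of_sideFun_ne_zero h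
  have e : halfCoord = fun p : I × I =>
      ((((1 - (p.1 : ℝ))⁻¹ - (p.1 : ℝ)⁻¹ : ℝ) : ℂ) + (((p.2 : ℝ)⁻¹ - 1 : ℝ) : ℂ) * Complex.I) := by
    ext p
    exact (Complex.mk_eq_add_mul_I _ _)
  have h1 : (1 - (p.1 : ℝ)) ≠ 0 := by linarith
  have hx : ContinuousAt (fun p : I × I => (p.1 : ℝ)) p := by fun_prop
  have ht' : ContinuousAt (fun p : I × I => (p.2 : ℝ)) p := by fun_prop
  rw [e]
  refine ContinuousAt.add (Complex.continuous_ofReal.continuousAt.comp ?_)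
    ((Complex.continuous_ofReal.continuousAt.comp ?_).mul continuousAt_const)
  · exact ((continuousAt_const.sub hx).inv₀ h1).sub (hx.inv₀ hx0.ne')
  · exact (ht'.inv₀ ht.ne').sub continuousAt_const

open Classical in
/-- The map of the square onto the closed upper half plane together with `∞`, which collapses three
sides to `∞` and maps the side `t = 1` onto the real axis. -/
def halfMap : C(I × I, S2) where
  toFun p := if sideFun p = 0 then ∞ else (halfCoord p : S2)
  continuous_toFun := by
    rw [continuous_iff_continuousAt]
    intro p
    by_cases h : sideFun p = 0
    · rw [ContinuousAt, if_pos h, OnePoint.hasBasis_nhds_infty.tendsto_right_iff]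
      rintro s ⟨-, hs⟩
      obtain ⟨R, hR0, hR⟩ := hs.isBounded.exists_pos_norm_le
      have hlt : ∀ᶠ q in 𝓝 p, sideFun q < (R + 4)⁻¹ :=
        continuous_sideFun.continuousAt.eventually_lt continuousAt_const (by rw [h]; positivity)
      filter_upwards [hlt] with q hq
      split_ifs with hq0
      · exact Or.inr rfl
      · refine Or.inl ⟨_, fun hmem => ?_, rfl⟩
        have h1 := inv_sideFun_le q hq0
        have hpos : 0 < sideFun q := lt_of_le_of_ne (sideFun_nonneg q) (Ne.symm hq0)
        have h2 : R + 4 < (sideFun q)⁻¹ := by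
          rw [lt_inv_comm₀ (by positivity) hpos]
          exact hq
        linarith [hR _ hmem]
    · have hne : ∀ᶠ q in 𝓝 p, sideFun q ≠ 0 :=
        continuous_sideFun.continuousAt.eventually_ne h
      refine ContinuousAt.congr (f := fun q => (halfCoord q : S2)) ?_ ?_
      · exact OnePoint.continuous_coe.continuousAt.comp (continuousAt_halfCoord h)
      · filter_upwards [hne] with q hq
        rw [if_neg hq]

theorem halfMap_of_eq_zero {p : I × I} (h : sideFun p = 0) : halfMap p = ∞ := if_pos h

theorem halfMap_of_ne_zero {p : I × I} (h : sideFun p ≠ 0) : halfMap p = (halfCoord p : S2) :=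
  if_neg h

theorem halfMap_eq_infty_iff (p : I × I) : halfMap p = ∞ ↔ p.1 = 0 ∨ p.1 = 1 ∨ p.2 = 0 := by
  rw [← sideFun_eq_zero_iff]
  refine ⟨fun h => ?_, halfMap_of_eq_zero⟩
  by_contra h'
  rw [halfMap_of_ne_zero h'] at h
  exact OnePoint.coe_ne_infty _ h

theorem halfCoord_injOn {p q : I × I} (hp : sideFun p ≠ 0) (hq : sideFun q ≠ 0)
    (h : halfCoord p = halfCoord q) : p = q := by
  obtain ⟨hx0, hx1, ht⟩ := pos_of_sideFun_ne_zero hp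
  obtain ⟨hx0', hx1', ht'⟩ := pos_of_sideFun_ne_zero hq
  have hre := congrArg Complex.re h
  have him := congrArg Complex.im h
  simp only [halfCoord, sub_left_inj, inv_inj] at hre him
  refine Prod.ext (Subtype.ext ?_) (Subtype.ext him)
  generalize (p.1 : ℝ) = x at *
  generalize (q.1 : ℝ) = y at *
  rcases lt_trichotomy x y with hlt | heq | hlt
  · have h1 := inv_strictAnti₀ hx0 hlt
    have h2 := inv_strictAnti₀ (by linarith : 0 < 1 - y) (by linarith : 1 - y < 1 - x)
    linarith
  · exact heq
  · have h1 := inv_strictAnti₀ hx0' hlt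
    have h2 := inv_strictAnti₀ (by linarith : 0 < 1 - x) (by linarith : 1 - x < 1 - y)
    linarith

theorem exists_halfCoord_eq (z : ℂ) (hz : 0 ≤ z.im) :
    ∃ p : I × I, sideFun p ≠ 0 ∧ halfCoord p = z := by
  obtain ⟨x, hx0, hx1, hx⟩ : ∃ x : ℝ, 0 < x ∧ x < 1 ∧ (1 - x)⁻¹ - x⁻¹ = z.re := by
    -- With `δ = (2 + |Re z|)⁻¹ ≤ 1/2`, the value at `1 - δ` is at least `(2 + |Re z|) - 2`, and by
    -- antisymmetry the value at `δ` is at most `-|Re z|`. The intermediate value theorem then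
    -- applies on `[δ, 1 - δ]`.
    have hcont : ContinuousOn (fun x : ℝ => (1 - x)⁻¹ - x⁻¹) (Set.Icc (2 + |z.re|)⁻¹
        (1 - (2 + |z.re|)⁻¹)) := by
      have hpos : 0 < (2 + |z.re|)⁻¹ := by positivity
      refine ContinuousOn.sub (ContinuousOn.inv₀ (by fun_prop) ?_)
        (ContinuousOn.inv₀ (by fun_prop) ?_)
      · rintro x ⟨_, hx⟩
        have : 0 < 1 - x := by linarith
        exact this.ne'
      · rintro x ⟨hx, _⟩
        exact (hpos.trans_le hx).ne'
    have hle : (2 + |z.re|)⁻¹ ≤ 2⁻¹ := inv_anti₀ (by norm_num) (by linarith [abs_nonneg z.re])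
    have hpos : 0 < (2 + |z.re|)⁻¹ := by positivity
    have hb : (1 - (2 + |z.re|)⁻¹)⁻¹ ≤ 2 := by
      rw [inv_le_comm₀ (by linarith) (by norm_num)]
      linarith
    obtain ⟨x, ⟨h1, h2⟩, h3⟩ := intermediate_value_Icc (by linarith) hcont
      (show z.re ∈ Set.Icc _ _ by
        simp only [inv_inv, sub_sub_cancel]
        constructor
        · linarith [neg_abs_le z.re]
        · linarith [le_abs_self z.re])
    exact ⟨x, by linarith, by linarith, h3⟩
  have ht0 : 0 < (1 + z.im)⁻¹ := by positivity
  have ht1 : (1 + z.im)⁻¹ ≤ 1 := inv_le_one_of_one_le₀ (by linarith)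
  refine ⟨(⟨x, hx0.le, hx1.le⟩, ⟨(1 + z.im)⁻¹, ht0.le, ht1⟩), ?_, ?_⟩
  · rw [Ne, sideFun_eq_zero_iff]
    simp only [Subtype.ext_iff, Set.Icc.coe_zero, Set.Icc.coe_one]
    exact not_or.mpr ⟨hx0.ne', not_or.mpr ⟨hx1.ne, ht0.ne'⟩⟩
  · refine Complex.ext hx ?_
    simp [halfCoord]

theorem exists_halfMap_eq (w : S2) : ∃ p, halfMap p = w ∨ conjS2 (halfMap p) = w := by
  induction w using OnePoint.rec with
  | infty => exact ⟨0, Or.inl ((halfMap_eq_infty_iff _).mpr (Or.inl rfl))⟩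
  | coe z =>
    rcases le_total 0 z.im with h | h
    · obtain ⟨p, hp, rfl⟩ := exists_halfCoord_eq z h
      exact ⟨p, Or.inl (halfMap_of_ne_zero hp)⟩
    · obtain ⟨p, hp, hpz⟩ := exists_halfCoord_eq (conj z) (by simpa using h)
      exact ⟨p, Or.inr (by rw [halfMap_of_ne_zero hp, hpz]; simp)⟩

theorem conjS2_halfMap_one (x : I) : conjS2 (halfMap (x, 1)) = halfMap (x, 1) := by
  by_cases h : sideFun (x, 1) = 0
  · rw [halfMap_of_eq_zero h]
    rfl
  · rw [halfMap_of_ne_zero h, conjS2_coe]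
    congr 1
    refine Complex.ext ?_ ?_ <;> simp [halfCoord]

theorem halfMap_eq {p q : I × I} (h : halfMap p = halfMap q) :
    (halfMap p = ∞ ∧ halfMap q = ∞) ∨ p = q := by
  by_cases hp : sideFun p = 0
  · exact Or.inl ⟨halfMap_of_eq_zero hp, h ▸ halfMap_of_eq_zero hp⟩
  · by_cases hq : sideFun q = 0
    · exact Or.inl ⟨h ▸ halfMap_of_eq_zero hq, halfMap_of_eq_zero hq⟩
    · rw [halfMap_of_ne_zero hp, halfMap_of_ne_zero hq] at h
      exact Or.inr (halfCoord_injOn hp hq (OnePoint.coe_injective h))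

/-- The two closed half planes meet only in the real axis and `∞`: the imaginary parts `1/t - 1` are
nonnegative on one side and nonpositive on the other, so both vanish. -/
theorem halfMap_eq_conjS2 {p q : I × I} (h : halfMap p = conjS2 (halfMap q)) :
    (halfMap p = ∞ ∧ halfMap q = ∞) ∨ (p = q ∧ p.2 = 1) := by
  by_cases hq : sideFun q = 0
  · rw [halfMap_of_eq_zero hq] at h
    exact Or.inl ⟨h, halfMap_of_eq_zero hq⟩
  by_cases hp : sideFun p = 0
  · rw [halfMap_of_eq_zero hp, halfMap_of_ne_zero hq, conjS2_coe] at h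
    exact absurd h.symm (OnePoint.coe_ne_infty _)
  have h' := h
  rw [halfMap_of_ne_zero hp, halfMap_of_ne_zero hq, conjS2_coe] at h'
  have him := congrArg Complex.im (OnePoint.coe_injective h')
  simp only [halfCoord, Complex.conj_im] at him
  have h1 : 1 ≤ (p.2 : ℝ)⁻¹ := (one_le_inv₀ (pos_of_sideFun_ne_zero hp).2.2).mpr p.2.2.2
  have h2 : 1 ≤ (q.2 : ℝ)⁻¹ := (one_le_inv₀ (pos_of_sideFun_ne_zero hq).2.2).mpr q.2.2.2
  have hq1 : q.2 = 1 := Subtype.ext (inv_eq_one.mp (by linarith : (q.2 : ℝ)⁻¹ = 1))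
  have hp1 : p.2 = 1 := Subtype.ext (inv_eq_one.mp (by linarith : (p.2 : ℝ)⁻¹ = 1))
  rw [show q = (q.1, 1) from Prod.ext rfl hq1, conjS2_halfMap_one] at h
  rcases halfMap_eq h with h | h
  · exact Or.inl (by rwa [show q = (q.1, 1) from Prod.ext rfl hq1])
  · exact Or.inr ⟨by rw [h]; exact Prod.ext rfl hq1.symm, hp1⟩

/-- Precomposition with two jointly surjective maps from compact spaces to a Hausdorff space is
inducing for the compact-open topology. -/
theorem isInducing_precomp_pair {K T Z : Type*} [TopologicalSpace K] [CompactSpace K]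
    [TopologicalSpace T] [T2Space T] [TopologicalSpace Z] (f g : C(K, T))
    (h : ∀ w, ∃ p, f p = w ∨ g p = w) :
    Topology.IsInducing fun φ : C(T, Z) => (φ.comp f, φ.comp g) := by
  refine ⟨le_antisymm ?_ ?_⟩
  · exact continuous_iff_le_induced.mp
      ((ContinuousMap.continuous_precomp f).prodMk (ContinuousMap.continuous_precomp g))
  · conv_rhs => rw [ContinuousMap.compactOpen_eq]
    refine le_generateFrom ?_
    rintro _ ⟨C, hC, U, hU, rfl⟩
    have hf : IsCompact (f ⁻¹' C) := (hC.isClosed.preimage f.continuous).isCompact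
    have hg : IsCompact (g ⁻¹' C) := (hC.isClosed.preimage g.continuous).isCompact
    -- By joint surjectivity `C` is the union of the images of its two preimages, so `φ(C) ⊆ U` is a
    -- pair of subbasic conditions on `φ ∘ f` and `φ ∘ g`.
    refine ⟨{φ | Set.MapsTo φ.1 (f ⁻¹' C) U} ∩ {φ | Set.MapsTo φ.2 (g ⁻¹' C) U}, ?_, ?_⟩
    · exact ((ContinuousMap.isOpen_setOfPred_mapsTo hf hU).preimage continuous_fst).inter
        ((ContinuousMap.isOpen_setOfPred_mapsTo hg hU).preimage continuous_snd)
    · ext φ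
      constructor
      · rintro ⟨h1, h2⟩ w hw
        obtain ⟨p, rfl | rfl⟩ := h w
        exacts [h1 hw, h2 hw]
      · exact fun hφ => ⟨fun p hp => hφ hp, fun p hp => hφ hp⟩

/-! ### Descent from the square to equivariant maps of the sphere -/

section Descent

variable {N : ℕ}

/-- The self map `x ↦ conj x` of `S²`. -/
def conjS2Map : C(S2, S2) := ⟨conjS2, continuous_conjS2⟩

/-- A map of the square that is constant on three sides and real on the fourth one descends to an
equivariant map of the sphere. -/
theorem exists_descent (g : C(I × I, CP N)) (hb : ∀ p, halfMap p = ∞ → g p = baseCP N)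
    (hr : ∀ x, conjCP N (g (x, 1)) = g (x, 1)) :
    ∃ f : BasedMap N, (∀ x, f.1 (conjS2 x) = conjCP N (f.1 x)) ∧ ∀ p, f.1 (halfMap p) = g p := by
  -- Two squares, one for each half plane. A continuous surjection from a compact space to a
  -- Hausdorff space is a quotient map, so compatibility of values is all that must be checked.
  let D : C((I × I) ⊕ (I × I), S2) :=
    ⟨Sum.elim halfMap (conjS2 ∘ halfMap), halfMap.continuous.sumElim
      (continuous_conjS2.comp halfMap.continuous)⟩
  let G : C((I × I) ⊕ (I × I), CP N) :=
    ⟨Sum.elim g (conjCP N ∘ g), g.continuous.sumElim (continuous_conjCP.comp g.continuous)⟩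
  have hD : Topology.IsQuotientMap D := by
    refine Topology.IsQuotientMap.of_surjective_continuous ?_ D.continuous
    intro w
    obtain ⟨p, h | h⟩ := exists_halfMap_eq w
    exacts [⟨Sum.inl p, h⟩, ⟨Sum.inr p, h⟩]
  have key : ∀ p q, halfMap p = conjS2 (halfMap q) → g p = conjCP N (g q) := by
    intro p q h
    rcases halfMap_eq_conjS2 h with ⟨h1, h2⟩ | ⟨rfl, h1⟩
    · rw [hb p h1, hb q h2, conjCP_baseCP]
    · rw [show p = (p.1, 1) from Prod.ext rfl h1, hr]
  have key' : ∀ p q, halfMap p = halfMap q → g p = g q := by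
    intro p q h
    rcases halfMap_eq h with ⟨h1, h2⟩ | rfl
    · rw [hb p h1, hb q h2]
    · rfl
  have hG : Function.FactorsThrough G D := by
    rintro (p | p) (q | q) h
    · exact key' p q h
    · exact key p q h
    · exact (key q p h.symm).symm
    · refine congrArg (conjCP N) (key' p q ?_)
      simpa using congrArg conjS2 (show conjS2 (halfMap p) = conjS2 (halfMap q) from h)
  have hl : ∀ p, hD.lift G hG (D p) = G p := fun p =>
    DFunLike.congr_fun (hD.lift_comp G hG) p
  have h1 : ∀ p, hD.lift G hG (halfMap p) = g p := fun p => hl (Sum.inl p)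
  have h2 : ∀ p, hD.lift G hG (conjS2 (halfMap p)) = conjCP N (g p) := fun p => hl (Sum.inr p)
  refine ⟨⟨hD.lift G hG, ?_⟩, ?_, h1⟩
  · have h0 : halfMap 0 = ∞ := (halfMap_eq_infty_iff _).mpr (Or.inl rfl)
    rw [← h0, h1, hb _ h0]
  · intro x
    obtain ⟨p, rfl | rfl⟩ := exists_halfMap_eq x
    · rw [h2, h1]
    · rw [h2, conjS2_conjS2, h1, conjCP_conjCP]

/-- The space of all equivariant based maps `S² → ℂP^N`. -/
abbrev AllEquivariantMaps (N : ℕ) : Type :=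
  {f : BasedMap N // ∀ x : S2, f.1 (conjS2 x) = conjCP N (f.1 x)}

theorem equivariant_ext {f g : AllEquivariantMaps N}
    (h : ∀ p, f.1.1 (halfMap p) = g.1.1 (halfMap p)) : f = g := by
  refine Subtype.ext (Subtype.ext (ContinuousMap.ext fun w => ?_))
  obtain ⟨p, rfl | rfl⟩ := exists_halfMap_eq w
  · exact h p
  · rw [f.2, g.2, h]

/-- Equivariant maps depend continuously on their restriction to the upper half plane. -/
theorem continuous_equivariantMaps {A : Type*} [TopologicalSpace A] {F : A → AllEquivariantMaps N}
    (h : Continuous fun q : A × (I × I) => (F q.1).1.1 (halfMap q.2)) : Continuous F := by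
  refine Continuous.subtype_mk (f := fun a => (F a).1)
    (Continuous.subtype_mk (f := fun a => (F a).1.1) ?_ _) _
  rw [(isInducing_precomp_pair halfMap (conjS2Map.comp halfMap)
    exists_halfMap_eq).continuous_iff]
  refine (continuous_into_continuousMap h).prodMk (continuous_into_continuousMap ?_)
  refine (continuous_conjCP.comp h).congr fun q => ?_
  exact ((F q.1).2 _).symm

end Descent

/-! ### Path lifting from `ℂP^N` to the sphere -/

/-- The hermitian space `ℂ^(N+1)`. -/
abbrev Vec (N : ℕ) : Type := EuclideanSpace ℂ (Fin (N + 1))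

section Projection

variable {N : ℕ}

theorem ofLp_ne_zero {v : Vec N} (hv : v ≠ 0) : v.ofLp ≠ 0 := fun h =>
  hv ((WithLp.ofLp_eq_zero 2).mp h)

/-- The line spanned by a nonzero vector. -/
def lineOf (v : Vec N) (hv : v ≠ 0) : CP N := Projectivization.mk ℂ v.ofLp (ofLp_ne_zero hv)

theorem continuous_lineOf {X : Type*} [TopologicalSpace X] (v : X → Vec N) (hv : ∀ x, v x ≠ 0)
    (hc : Continuous v) : Continuous fun x => lineOf (v x) (hv x) :=
  continuous_mk (fun x => (v x).ofLp) (fun x => ofLp_ne_zero (hv x))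
    ((PiLp.continuous_ofLp 2 _).comp hc)

theorem exists_lineOf_eq (x : CP N) : ∃ v hv, lineOf (N := N) v hv = x := by
  induction x using Projectivization.ind with
  | h v hv => exact ⟨WithLp.toLp 2 v, fun h => hv ((WithLp.toLp_eq_zero 2).mp h), rfl⟩

theorem lineOf_eq_iff (v w : Vec N) (hv : v ≠ 0) (hw : w ≠ 0) :
    lineOf v hv = lineOf w hw ↔ ∃ a : ℂ, a • w = v := by
  rw [lineOf, lineOf, Projectivization.mk_eq_mk_iff']
  refine exists_congr fun a => ?_
  rw [← WithLp.ofLp_smul]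
  exact (WithLp.ofLp_injective 2).eq_iff

/-- The orthogonal projection to the line spanned by `w`, as a function of `w`. -/
def projVec (w v : Vec N) : Vec N := (⟪w, v⟫_ℂ / ⟪w, w⟫_ℂ) • w

theorem projVec_smul_left {c : ℂ} (hc : c ≠ 0) (w v : Vec N) :
    projVec (c • w) v = projVec w v := by
  simp only [projVec, inner_smul_left, inner_smul_right, smul_smul]
  have hc' : conj c ≠ 0 := by simpa using hc
  by_cases hw : w = 0
  · simp [hw]
  have : ⟪w, w⟫_ℂ ≠ 0 := inner_self_ne_zero.mpr hw
  congr 1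
  field_simp

/-- The orthogonal projection to a line. -/
def proj (x : CP N) (v : Vec N) : Vec N :=
  x.lift (fun w => projVec (WithLp.toLp 2 w.1) v) (by
    rintro ⟨a, ha⟩ ⟨b, hb⟩ t h
    have ht : t ≠ 0 := by
      rintro rfl
      exact ha (by simpa using h)
    simp only at h ⊢
    rw [h, WithLp.toLp_smul, projVec_smul_left ht])

theorem proj_lineOf (w v : Vec N) (hw : w ≠ 0) : proj (lineOf w hw) v = projVec w v := rfl

theorem proj_smul (x : CP N) (c : ℂ) (v : Vec N) : proj x (c • v) = c • proj x v := by
  obtain ⟨w, hw, rfl⟩ := exists_lineOf_eq x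
  simp only [proj_lineOf, projVec, inner_smul_right, smul_smul, mul_div_assoc]

@[simp]
theorem proj_lineOf_self (w : Vec N) (hw : w ≠ 0) : proj (lineOf w hw) w = w := by
  rw [proj_lineOf, projVec, div_self (inner_self_ne_zero.mpr hw), one_smul]

theorem lineOf_eq_of_proj_eq {x : CP N} {v : Vec N} (hv : v ≠ 0) (h : proj x v = v) :
    lineOf v hv = x := by
  obtain ⟨w, hw, rfl⟩ := exists_lineOf_eq x
  rw [lineOf_eq_iff]
  exact ⟨_, h⟩

theorem exists_proj_eq_smul {x : CP N} {v : Vec N} (hv : v ≠ 0) (h : proj x v = v) (u : Vec N) :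
    ∃ c : ℂ, proj x u = c • v := by
  obtain rfl := lineOf_eq_of_proj_eq hv h
  exact ⟨_, rfl⟩

@[simp]
theorem proj_proj (x : CP N) (v : Vec N) : proj x (proj x v) = proj x v := by
  obtain ⟨w, hw, rfl⟩ := exists_lineOf_eq x
  conv_lhs => rw [proj_lineOf w v hw, projVec, proj_smul, proj_lineOf_self]
  rfl

/-- The saturation of an open set is the union of its scalar translates. Openness, and not just
being a quotient map, is what survives the product with `Vec N` in `continuous_proj`. -/
theorem isOpenQuotientMap_mk :
    IsOpenQuotientMap fun v : {v : Fin (N + 1) → ℂ // v ≠ 0} =>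
      (Projectivization.mk ℂ v.1 v.2 : CP N) := by
  refine ⟨?_, continuous_quotient_mk', ?_⟩
  · intro x
    induction x using Projectivization.ind with
    | h v hv => exact ⟨⟨v, hv⟩, rfl⟩
  · intro U hU
    change IsOpen ((fun v : {v : Fin (N + 1) → ℂ // v ≠ 0} =>
      (Projectivization.mk ℂ v.1 v.2 : CP N)) ⁻¹' _)
    have : (fun v : {v : Fin (N + 1) → ℂ // v ≠ 0} =>
        (Projectivization.mk ℂ v.1 v.2 : CP N)) ⁻¹' ((fun v : {v : Fin (N + 1) → ℂ // v ≠ 0} =>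
        (Projectivization.mk ℂ v.1 v.2 : CP N)) '' U) =
        ⋃ c : ℂˣ, (fun v : {v : Fin (N + 1) → ℂ // v ≠ 0} =>
          (⟨c • v.1, (smul_ne_zero_iff_ne c).mpr v.2⟩ : {v : Fin (N + 1) → ℂ // v ≠ 0})) ⁻¹' U := by
      ext v
      simp only [Set.mem_preimage, Set.mem_image, Set.mem_iUnion]
      constructor
      · rintro ⟨u, hu, h⟩
        obtain ⟨c, hc⟩ := (Projectivization.mk_eq_mk_iff ℂ _ _ _ _).mp h
        refine ⟨c, ?_⟩
        convert hu
      · rintro ⟨c, hc⟩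
        exact ⟨_, hc, (Projectivization.mk_eq_mk_iff ℂ _ _ _ _).mpr ⟨c, rfl⟩⟩
    rw [this]
    exact isOpen_iUnion fun c => hU.preimage (by fun_prop)

theorem continuous_proj : Continuous fun p : CP N × Vec N => proj p.1 p.2 := by
  rw [(isOpenQuotientMap_mk.prodMap (IsOpenQuotientMap.id (X := Vec N))).isQuotientMap.continuous_iff]
  change Continuous fun p : {v : Fin (N + 1) → ℂ // v ≠ 0} × Vec N =>
    projVec (WithLp.toLp 2 p.1.1) p.2
  have hw : Continuous fun p : {v : Fin (N + 1) → ℂ // v ≠ 0} × Vec N =>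
      (WithLp.toLp 2 p.1.1 : Vec N) := by fun_prop
  exact ((hw.inner (𝕜 := ℂ) continuous_snd).div (hw.inner (𝕜 := ℂ) hw) fun p =>
    inner_self_ne_zero.mpr fun h => p.1.2 ((WithLp.toLp_eq_zero 2).mp h)).smul hw

theorem continuous_proj_comp {A : Type*} [TopologicalSpace A] {f : A → CP N} {g : A → Vec N}
    (hf : Continuous f) (hg : Continuous g) : Continuous fun a => proj (f a) (g a) := by
  have h := (continuous_proj (N := N)).comp (hf.prodMk hg)
  exact h

/-- A measure of how far two lines are from being orthogonal. -/
def overlap (x y : CP N) : ℝ :=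
  ∑ i, ‖proj x (proj y (EuclideanSpace.single i 1))‖

theorem continuous_overlap {A : Type*} [TopologicalSpace A] {f g : A → CP N}
    (hf : Continuous f) (hg : Continuous g) : Continuous fun a => overlap (f a) (g a) := by
  exact continuous_finsetSum _ fun i _ =>
    (continuous_proj_comp hf (continuous_proj_comp hg continuous_const)).norm

theorem overlap_nonneg (x y : CP N) : 0 ≤ overlap x y :=
  Finset.sum_nonneg fun _ _ => norm_nonneg _

theorem overlap_self_pos (x : CP N) : 0 < overlap x x := by
  refine lt_of_le_of_ne (overlap_nonneg x x) fun h => ?_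
  obtain ⟨w, hw, rfl⟩ := exists_lineOf_eq x
  have h0 := (Finset.sum_eq_zero_iff_of_nonneg fun _ _ => norm_nonneg _).mp h.symm
  refine hw (PiLp.ext fun i => ?_)
  have h1 := h0 i (Finset.mem_univ i)
  rw [proj_proj, norm_eq_zero, proj_lineOf, projVec, smul_eq_zero, or_iff_left hw,
    div_eq_zero_iff, or_iff_left (inner_self_ne_zero.mpr hw)] at h1
  simpa [EuclideanSpace.inner_single_right] using h1

/-- Lines are one-dimensional: if one nonzero vector of `y` projected to zero in `x`, then all of
`y` would, and the overlap would vanish. -/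
theorem proj_ne_zero_of_overlap {x y : CP N} (h : 0 < overlap x y) {v : Vec N} (hv : v ≠ 0)
    (hy : proj y v = v) : proj x v ≠ 0 := by
  intro h0
  refine h.ne' (Finset.sum_eq_zero fun i _ => ?_)
  obtain ⟨c, hc⟩ := exists_proj_eq_smul hv hy (EuclideanSpace.single i 1)
  rw [hc, proj_smul, h0, smul_zero, norm_zero]

/-- Points of a path at parameters closer than the gap are not orthogonal. -/
def gap (γ : C(I, CP N)) : ℝ :=
  sInf ((fun p : I × I => max (dist p.1 p.2) (overlap (γ p.1) (γ p.2))) '' Set.univ)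

/-- The step size of the transport has to vary continuously with the path. An infimum over a compact
square does so, whereas a subdivision chosen by compactness would not. -/
theorem continuous_gap : Continuous (gap (N := N)) := by
  refine IsCompact.continuous_sInf (f := fun (γ : C(I, CP N)) (p : I × I) =>
    max (dist p.1 p.2) (overlap (γ p.1) (γ p.2))) isCompact_univ ?_
  exact (by fun_prop : Continuous fun q : C(I, CP N) × (I × I) => dist q.2.1 q.2.2).max
    (continuous_overlap (f := fun q : C(I, CP N) × (I × I) => q.1 q.2.1)
      (g := fun q : C(I, CP N) × (I × I) => q.1 q.2.2) (by fun_prop) (by fun_prop))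

theorem continuous_gap_aux (γ : C(I, CP N)) :
    Continuous fun p : I × I => max (dist p.1 p.2) (overlap (γ p.1) (γ p.2)) :=
  (by fun_prop : Continuous fun p : I × I => dist p.1 p.2).max
    (continuous_overlap (γ.continuous.comp continuous_fst) (γ.continuous.comp continuous_snd))

/-- The infimum is attained by compactness. Off the diagonal the distance is positive, and on it the
overlap of a line with itself is. -/
theorem gap_pos (γ : C(I, CP N)) : 0 < gap γ := by
  obtain ⟨p, -, hp⟩ := (isCompact_univ.image (continuous_gap_aux γ)).sInf_mem
    (Set.image_nonempty.mpr Set.univ_nonempty)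
  rw [gap, ← hp]
  by_cases h : p.1 = p.2
  · refine lt_max_of_lt_right ?_
    rw [h]
    exact overlap_self_pos _
  · exact lt_max_of_lt_left (dist_pos.mpr h)

theorem overlap_pos_of_dist_lt_gap {γ : C(I, CP N)} {s t : I} (h : dist s t < gap γ) :
    0 < overlap (γ s) (γ t) := by
  have h1 : gap γ ≤ max (dist s t) (overlap (γ s) (γ t)) :=
    csInf_le (isCompact_univ.image (continuous_gap_aux γ)).bddBelow
      ⟨(s, t), Set.mem_univ _, rfl⟩
  rcases le_max_iff.mp h1 with h2 | h2
  · linarith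
  · exact (gap_pos γ).trans_le h2

/-- The `k`-th subdivision point of the interval from `τ` to `t`. -/
def stepTime (γ : C(I, CP N)) (τ t : I) (k : ℕ) : I := min t (clamp (τ + k * (gap γ / 2)))

/-- The result of `k` successive projections along a path. -/
def stepLift (γ : C(I, CP N)) (v : Vec N) (τ t : I) : ℕ → Vec N
  | 0 => v
  | k + 1 => proj (γ (stepTime γ τ t (k + 1))) (stepLift γ v τ t k)

/-- The transport of the vector `v` from time `τ` to time `t` along a path of lines. -/
def pathLift (γ : C(I, CP N)) (v : Vec N) (τ t : I) : Vec N :=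
  stepLift γ v τ t (⌈(gap γ / 2)⁻¹⌉₊ + 1)

theorem stepTime_eq {γ : C(I, CP N)} (τ t : I) {k : ℕ} (hk : ⌈(gap γ / 2)⁻¹⌉₊ ≤ k) :
    stepTime γ τ t k = t := by
  have hg := gap_pos γ
  have h1 : (gap γ / 2)⁻¹ ≤ k := (Nat.le_ceil _).trans (by exact_mod_cast hk)
  have h2 : 1 ≤ k * (gap γ / 2) := by
    rwa [inv_le_iff_one_le_mul₀ (by positivity)] at h1
  rw [stepTime, clamp_of_one_le (by linarith [τ.2.1])]
  exact min_eq_left t.2.2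

/-- Once the subdivision point has reached `t`, further projections go to the same line and change
nothing. Hence the number of steps may be taken locally constant in the path, although the ceiling
in `pathLift` jumps. -/
theorem stepLift_stable (γ : C(I, CP N)) (v : Vec N) (τ t : I) {n : ℕ}
    (hn : ⌈(gap γ / 2)⁻¹⌉₊ + 1 ≤ n) : stepLift γ v τ t n = pathLift γ v τ t := by
  induction n, hn using Nat.le_induction with
  | base => rfl
  | succ n hn ih =>
    rw [stepLift, ih, pathLift, stepLift, stepTime_eq τ t (by omega), stepTime_eq τ t (by omega),
      proj_proj]

theorem continuous_stepLift (k : ℕ) : Continuous fun q : C(I, CP N) × Vec N × I × I =>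
    stepLift q.1 q.2.1 q.2.2.1 q.2.2.2 k := by
  induction k with
  | zero =>
    simp only [stepLift]
    fun_prop
  | succ k ih =>
    simp only [stepLift]
    refine continuous_proj_comp ?_ ih
    unfold stepTime
    refine Continuous.eval continuous_fst (Continuous.min (by fun_prop) (continuous_clamp_comp ?_))
    have := continuous_gap (N := N)
    fun_prop

theorem continuous_pathLift : Continuous fun q : C(I, CP N) × Vec N × I × I =>
    pathLift q.1 q.2.1 q.2.2.1 q.2.2.2 := by
  rw [continuous_iff_continuousAt]
  intro q₀
  have hinv : Continuous fun q : C(I, CP N) × Vec N × I × I => (gap q.1 / 2)⁻¹ := by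
    refine Continuous.inv₀ ?_ fun q => (half_pos (gap_pos _)).ne'
    have := continuous_gap (N := N)
    fun_prop
  have hev : ∀ᶠ q in 𝓝 q₀, (gap q.1 / 2)⁻¹ < (gap q₀.1 / 2)⁻¹ + 1 :=
    hinv.continuousAt.eventually_lt continuousAt_const (by linarith)
  -- Near `q₀` the ceiling grows by at most one, and `pathLift` itself takes one step more than the
  -- ceiling; this many steps therefore suffice on a whole neighbourhood.
  refine (continuous_stepLift (⌈(gap q₀.1 / 2)⁻¹⌉₊ + 2)).continuousAt.congr ?_
  filter_upwards [hev] with q hq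
  refine stepLift_stable _ _ _ _ ?_
  have : ⌈(gap q.1 / 2)⁻¹⌉₊ ≤ ⌈(gap q₀.1 / 2)⁻¹⌉₊ + 1 := by
    refine Nat.ceil_le.mpr (hq.le.trans ?_)
    push_cast
    linarith [Nat.le_ceil (gap q₀.1 / 2)⁻¹]
  omega

theorem dist_stepTime_lt (γ : C(I, CP N)) (τ t : I) (k : ℕ) :
    dist (stepTime γ τ t (k + 1)) (stepTime γ τ t k) < gap γ := by
  have hg := gap_pos γ
  have h1 : ∀ a b : ℝ, |max 0 (min 1 a) - max 0 (min 1 b)| ≤ |a - b| := fun a b => by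
    refine (abs_max_sub_max_le_max _ _ _ _).trans ?_
    rw [sub_self, abs_zero, max_eq_right (abs_nonneg _)]
    refine (abs_min_sub_min_le_max _ _ _ _).trans ?_
    rw [sub_self, abs_zero, max_eq_right (abs_nonneg _)]
  have hmin : ∀ a b : I, ((min a b : I) : ℝ) = min (a : ℝ) b := fun a b =>
    Subtype.mono_coe _ |>.map_min
  rw [Subtype.dist_eq, Real.dist_eq, stepTime, stepTime, hmin, hmin]
  refine (abs_min_sub_min_le_max _ _ _ _).trans_lt ?_
  rw [sub_self, abs_zero, max_eq_right (abs_nonneg _), coe_clamp, coe_clamp]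
  refine (h1 _ _).trans_lt ?_
  push_cast
  rw [show (τ : ℝ) + (k + 1) * (gap γ / 2) - (τ + k * (gap γ / 2)) = gap γ / 2 by ring,
    abs_of_pos (by positivity)]
  linarith

/-- Consecutive subdivision points are closer than the gap, so no projection kills the vector. The
subdivision starts at `min t τ`, which is why `v` has to lie on the line at that time. -/
theorem stepLift_spec {γ : C(I, CP N)} {v : Vec N} {τ t : I} (hv : v ≠ 0)
    (h : proj (γ (min t τ)) v = v) (k : ℕ) :
    stepLift γ v τ t k ≠ 0 ∧
      proj (γ (stepTime γ τ t k)) (stepLift γ v τ t k) = stepLift γ v τ t k := by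
  induction k with
  | zero => simpa [stepLift, stepTime, hv] using h
  | succ k ih =>
    refine ⟨?_, by rw [stepLift, proj_proj]⟩
    rw [stepLift]
    exact proj_ne_zero_of_overlap (overlap_pos_of_dist_lt_gap (dist_stepTime_lt γ τ t k)) ih.1 ih.2

theorem pathLift_ne_zero {γ : C(I, CP N)} {v : Vec N} {τ t : I} (hv : v ≠ 0)
    (h : proj (γ (min t τ)) v = v) : pathLift γ v τ t ≠ 0 := (stepLift_spec hv h _).1

theorem proj_pathLift {γ : C(I, CP N)} {v : Vec N} {τ t : I} :
    proj (γ t) (pathLift γ v τ t) = pathLift γ v τ t := by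
  rw [pathLift, stepLift, stepTime_eq τ t (by omega), proj_proj]

/-- This keeps base points fixed under transport, and it makes transport over a trivial time
interval the identity. -/
theorem pathLift_eq_self {γ : C(I, CP N)} {v : Vec N} {τ t : I}
    (h : ∀ s, min t τ ≤ s → s ≤ t → proj (γ s) v = v) : pathLift γ v τ t = v := by
  have hg := gap_pos γ
  rw [pathLift]
  generalize ⌈(gap γ / 2)⁻¹⌉₊ + 1 = k
  induction k with
  | zero => rfl
  | succ k ih =>
    rw [stepLift, ih]
    refine h _ (min_le_min le_rfl ?_) (min_le_left _ _)
    conv_lhs => rw [← clamp_coe τ]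
    exact Set.monotone_projIcc _ (le_add_of_nonneg_right (by positivity))

end Projection

/-! ### Lifting maps of the upper half plane to paths of loops on the sphere -/

section Lift

variable {N : ℕ}

/-- The unit sphere of `ℂ^(N+1)`. -/
abbrev USph (N : ℕ) : Type := Metric.sphere (0 : Vec N) 1

theorem USph.ne_zero (u : USph N) : (u : Vec N) ≠ 0 := ne_zero_of_mem_unit_sphere u

@[simp]
theorem USph.norm_eq (u : USph N) : ‖(u : Vec N)‖ = 1 := norm_eq_of_mem_sphere u

/-- The unit vector in the direction of a nonzero vector. -/
def toUnit (v : Vec N) (hv : v ≠ 0) : USph N :=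
  ⟨(‖v‖ : ℂ)⁻¹ • v, by
    rw [mem_sphere_zero_iff_norm, norm_smul, norm_inv, Complex.norm_real, norm_norm,
      inv_mul_cancel₀ (norm_ne_zero_iff.mpr hv)]⟩

theorem coe_toUnit (v : Vec N) (hv : v ≠ 0) : (toUnit v hv : Vec N) = (‖v‖ : ℂ)⁻¹ • v := rfl

theorem toUnit_coe (u : USph N) : toUnit (u : Vec N) u.ne_zero = u :=
  Subtype.ext (by simp [coe_toUnit])

theorem toUnit_eq {v : Vec N} (hv : v ≠ 0) {u : USph N} (h : v = u) : toUnit v hv = u := by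
  subst h
  exact toUnit_coe u

theorem toUnit_congr {v w : Vec N} (hv : v ≠ 0) (hw : w ≠ 0) (h : v = w) :
    toUnit v hv = toUnit w hw := by
  subst h
  rfl

theorem continuous_toUnit {X : Type*} [TopologicalSpace X] (v : X → Vec N) (hv : ∀ x, v x ≠ 0)
    (hc : Continuous v) : Continuous fun x => toUnit (v x) (hv x) := by
  have h : Continuous fun x => (‖v x‖ : ℂ) := Complex.continuous_ofReal.comp hc.norm
  exact Continuous.subtype_mk ((h.inv₀ fun x => by simpa using hv x).smul hc) _

/-- The complex line through a point of the unit sphere. -/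
def line (u : USph N) : CP N := lineOf (u : Vec N) u.ne_zero

theorem continuous_line : Continuous (line (N := N)) :=
  continuous_lineOf _ _ continuous_subtype_val

theorem line_toUnit (v : Vec N) (hv : v ≠ 0) : line (toUnit v hv) = lineOf v hv :=
  (lineOf_eq_iff _ _ _ _).mpr ⟨_, rfl⟩

@[simp]
theorem proj_line (u : USph N) : proj (line u) (u : Vec N) = u := proj_lineOf_self _ _

/-- The base point of the unit sphere, over the base point of `ℂP^N`. -/
def baseU (N : ℕ) : USph N :=
  toUnit (WithLp.toLp 2 fun _ => 1) fun h => ones_ne_zero N ((WithLp.toLp_eq_zero 2).mp h)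

@[simp]
theorem line_baseU : line (baseU N) = baseCP N := line_toUnit _ _

@[simp]
theorem proj_baseCP : proj (baseCP N) (baseU N : Vec N) = baseU N := by
  rw [← line_baseU, proj_line]

/-- The based loops on the unit sphere. -/
abbrev ULoop (N : ℕ) : Type := PathsInto (baseU N) {baseU N}

/-- A family of paths of loops on the sphere, from a family of nonvanishing vectors. -/
def loopFamily {A : Type*} [TopologicalSpace A] (W : A → I → I → Vec N)
    (hW : Continuous fun q : (A × I) × I => W q.1.1 q.1.2 q.2) (hne : ∀ a t x, W a t x ≠ 0)
    (h0 : ∀ a t, W a t 0 = baseU N) (h1 : ∀ a t, W a t 1 = baseU N) : C(A, C(I, ULoop N)) :=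
  ContinuousMap.curry ⟨fun q : A × I => ⟨⟨fun x => toUnit (W q.1 q.2 x) (hne _ _ _),
      continuous_toUnit _ _ (hW.comp (by fun_prop : Continuous fun x : I => (q, x)))⟩,
      toUnit_eq (hne _ _ _) (h0 _ _), toUnit_eq (hne _ _ _) (h1 _ _)⟩,
    Continuous.subtype_mk (continuous_into_continuousMap
      (continuous_toUnit _ (fun _ => hne _ _ _) hW)) fun q =>
        ⟨toUnit_eq (hne _ _ _) (h0 _ _), toUnit_eq (hne _ _ _) (h1 _ _)⟩⟩

section LoopFamily

variable {A : Type*} [TopologicalSpace A] (W : A → I → I → Vec N)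
    (hW : Continuous fun q : (A × I) × I => W q.1.1 q.1.2 q.2) (hne : ∀ a t x, W a t x ≠ 0)
    (h0 : ∀ a t, W a t 0 = baseU N) (h1 : ∀ a t, W a t 1 = baseU N)

theorem loopFamily_apply (a : A) (t x : I) :
    (loopFamily W hW hne h0 h1 a t).1 x = toUnit (W a t x) (hne a t x) := rfl

theorem loopFamily_eq {a : A} {t : I} {e : ULoop N} (h : ∀ x, W a t x = e.1 x) :
    loopFamily W hW hne h0 h1 a t = e :=
  Subtype.ext (ContinuousMap.ext fun x => toUnit_eq (hne a t x) (h x))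

theorem line_loopFamily (a : A) (t x : I) {ℓ : CP N} (h : proj ℓ (W a t x) = W a t x) :
    line ((loopFamily W hW hne h0 h1 a t).1 x) = ℓ := by
  rw [loopFamily_apply, line_toUnit]
  exact lineOf_eq_of_proj_eq _ h

theorem loopFamily_congr {B : Type*} [TopologicalSpace B] (W' : B → I → I → Vec N)
    (hW' : Continuous fun q : (B × I) × I => W' q.1.1 q.1.2 q.2) (hne' : ∀ a t x, W' a t x ≠ 0)
    (h0' : ∀ a t, W' a t 0 = baseU N) (h1' : ∀ a t, W' a t 1 = baseU N) {a : A} {b : B} {t s : I}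
    (h : ∀ x, W a t x = W' b s x) :
    loopFamily W hW hne h0 h1 a t = loopFamily W' hW' hne' h0' h1' b s :=
  Subtype.ext (ContinuousMap.ext fun x => toUnit_congr (hne a t x) (hne' b s x) (h x))

end LoopFamily

/-- The path in `ℂP^N` traced by a map along a vertical line of the upper half plane. -/
def verticalPath : C(BasedMap N × I, C(I, CP N)) :=
  ContinuousMap.curry ⟨fun q : (BasedMap N × I) × I => q.1.1.1 (halfMap (q.1.2, q.2)), by fun_prop⟩

@[simp]
theorem verticalPath_apply (f : BasedMap N) (x t : I) :
    verticalPath (f, x) t = f.1 (halfMap (x, t)) := rfl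

theorem apply_halfMap_of_infty (f : BasedMap N) {x t : I} (h : x = 0 ∨ x = 1 ∨ t = 0) :
    f.1 (halfMap (x, t)) = baseCP N := by
  rw [(halfMap_eq_infty_iff _).mpr h, f.2]

theorem continuous_pathLift_comp {A : Type*} [TopologicalSpace A] {γ : A → C(I, CP N)}
    {v : A → Vec N} {τ t : A → I} (hγ : Continuous γ) (hv : Continuous v) (hτ : Continuous τ)
    (ht : Continuous t) : Continuous fun a => pathLift (γ a) (v a) (τ a) (t a) := by
  have h := (continuous_pathLift (N := N)).comp (hγ.prodMk (hv.prodMk (hτ.prodMk ht)))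
  exact h

theorem proj_verticalPath_min (f : BasedMap N) (x t : I) :
    proj (verticalPath (f, x) (min t 0)) (baseU N : Vec N) = baseU N := by
  rw [verticalPath_apply, apply_halfMap_of_infty f (Or.inr (Or.inr (min_eq_right t.2.1))),
    proj_baseCP]

/-- The lift of a based map, restricted to the upper half plane, to the unit sphere. -/
def upperLift : C(BasedMap N, C(I, ULoop N)) :=
  loopFamily (fun f t x => pathLift (verticalPath (f, x)) (baseU N) 0 t)
    (continuous_pathLift_comp (verticalPath.continuous.comp (by fun_prop)) continuous_const
      continuous_const (by fun_prop))
    (fun f t x => pathLift_ne_zero (baseU N).ne_zero (proj_verticalPath_min f x t))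
    (fun f t => pathLift_eq_self fun s _ _ => by
      rw [verticalPath_apply, apply_halfMap_of_infty f (Or.inl rfl), proj_baseCP])
    (fun f t => pathLift_eq_self fun s _ _ => by
      rw [verticalPath_apply, apply_halfMap_of_infty f (Or.inr (Or.inl rfl)), proj_baseCP])

@[simp]
theorem line_upperLift (f : BasedMap N) (t x : I) :
    line ((upperLift f t).1 x) = f.1 (halfMap (x, t)) :=
  line_loopFamily _ _ _ _ _ _ _ _ proj_pathLift

@[simp]
theorem upperLift_zero (f : BasedMap N) : upperLift f 0 = constLoop (baseU N) := by
  refine loopFamily_eq _ _ _ _ _ fun x => pathLift_eq_self fun s _ hs => ?_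
  rw [verticalPath_apply, apply_halfMap_of_infty f (Or.inr (Or.inr (le_antisymm hs s.2.1))),
    proj_baseCP]

/-- The loops on the sphere that lie over `ℝP^N`. -/
def realLoops (N : ℕ) : Set (ULoop N) := {e | ∀ x, conjCP N (line (e.1 x)) = line (e.1 x)}

/-- The homotopy fibre of the inclusion of the loops over `ℝP^N`. -/
abbrev RealFiber (N : ℕ) : Type := PathsInto (constLoop (baseU N)) (realLoops N)

/-- Lifting equivariant maps over the upper half plane. -/
def equivariantLift : C(AllEquivariantMaps N, RealFiber N) :=
  ⟨fun f => ⟨upperLift f.1, upperLift_zero _, fun x => by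
      rw [line_upperLift, ← f.2, conjS2_halfMap_one]⟩,
    Continuous.subtype_mk (upperLift.continuous.comp continuous_subtype_val) _⟩

theorem equivariantLift_coe (f : AllEquivariantMaps N) : (equivariantLift f).1 = upperLift f.1 :=
  rfl

theorem coe_apply_zero (e : ULoop N) : e.1 0 = baseU N := e.2.1

theorem coe_apply_one (e : ULoop N) : e.1 1 = baseU N := e.2.2

/-- Projecting a path of loops to `ℂP^N` gives the base point on three sides of the square and
points of `ℝP^N` on the fourth. The descended maps can be chosen freely, since their values on the
upper half plane determine them and their continuity in `γ`. -/
theorem exists_descentMap : ∃ g : C(RealFiber N, AllEquivariantMaps N),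
    ∀ γ x t, (g γ).1.1 (halfMap (x, t)) = line ((γ.1 t).1 x) := by
  have h : ∀ γ : RealFiber N, ∃ f : AllEquivariantMaps N,
      ∀ p, f.1.1 (halfMap p) = line ((γ.1 p.2).1 p.1) := by
    intro γ
    have hb : ∀ p : I × I, halfMap p = ∞ → line ((γ.1 p.2).1 p.1) = baseCP N := by
      rintro ⟨x, t⟩ hp
      change line ((γ.1 t).1 x) = _
      rw [← line_baseU]
      rcases (halfMap_eq_infty_iff _).mp hp with h | h | h
      · rw [show x = 0 from h, coe_apply_zero]
      · rw [show x = 1 from h, coe_apply_one]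
      · rw [show t = 0 from h, γ.2.1]
        rfl
    obtain ⟨f, hf, hf'⟩ := exists_descent
      (⟨fun p => line ((γ.1 p.2).1 p.1), continuous_line.comp (by fun_prop)⟩ : C(I × I, CP N))
      hb fun x => γ.2.2 x
    exact ⟨⟨f, hf⟩, hf'⟩
  choose g hg using h
  refine ⟨⟨g, continuous_equivariantMaps ?_⟩, fun γ x t => hg γ (x, t)⟩
  simp only [hg]
  exact continuous_line.comp (by fun_prop)

/-- The path in `ℂP^N` below a path of loops. -/
def linePath : C(RealFiber N × I, C(I, CP N)) :=
  ContinuousMap.curry ⟨fun q : (RealFiber N × I) × I => line ((q.1.1.1 q.2).1 q.1.2),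
    continuous_line.comp (by fun_prop)⟩

@[simp]
theorem linePath_apply (γ : RealFiber N) (x t : I) :
    linePath (γ, x) t = line ((γ.1 t).1 x) := rfl

/-- Lifting equivariant maps identifies them up to homotopy with the homotopy fibre of the
inclusion of the loops over `ℝP^N`. -/
theorem exists_homotopyInverse_equivariantLift :
    ∃ g : C(RealFiber N, AllEquivariantMaps N), (∀ f, g (equivariantLift f) = f) ∧
      (equivariantLift.comp g).Homotopic (ContinuousMap.id (RealFiber N)) := by
  obtain ⟨g, hg⟩ := exists_descentMap (N := N)
  refine ⟨g, fun f => equivariant_ext fun p => ?_, ?_⟩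
  · rw [hg, equivariantLift_coe, line_upperLift]
  · let W : I × RealFiber N → I → I → Vec N := fun q t x =>
      pathLift (linePath (q.2, x)) ((q.2.1 (min t q.1)).1 x : Vec N) q.1 t
    have hW : Continuous fun q : ((I × RealFiber N) × I) × I => W q.1.1 q.1.2 q.2 := by
      refine continuous_pathLift_comp (linePath.continuous.comp (by fun_prop)) ?_ (by fun_prop)
        (by fun_prop)
      exact continuous_subtype_val.comp (by fun_prop)
    have hne : ∀ q t x, W q t x ≠ 0 := fun q t x =>
      pathLift_ne_zero (USph.ne_zero _) (by rw [linePath_apply, proj_line])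
    have h0 : ∀ q t, W q t 0 = baseU N := fun q t => by
      simp only [W, coe_apply_zero]
      refine pathLift_eq_self fun s _ _ => ?_
      rw [linePath_apply, coe_apply_zero, line_baseU, proj_baseCP]
    have h1 : ∀ q t, W q t 1 = baseU N := fun q t => by
      simp only [W, coe_apply_one]
      refine pathLift_eq_self fun s _ _ => ?_
      rw [linePath_apply, coe_apply_one, line_baseU, proj_baseCP]
    let H := loopFamily W hW hne h0 h1
    have hline : ∀ q t x, line ((H q t).1 x) = line ((q.2.1 t).1 x) := fun q t x =>
      line_loopFamily _ _ _ _ _ _ _ _ proj_pathLift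
    have hstart : ∀ q, H q 0 = constLoop (baseU N) := by
      intro q
      refine loopFamily_eq _ _ _ _ _ fun x => ?_
      have h00 : min (0 : I) q.1 = 0 := min_eq_left q.1.2.1
      simp only [W, h00, q.2.2.1]
      refine pathLift_eq_self fun s _ hs => ?_
      rw [le_antisymm hs s.2.1, linePath_apply, q.2.2.1, proj_line]
    have hend : ∀ q, H q 1 ∈ realLoops N := fun q x => by
      rw [hline]
      exact q.2.2.2 x
    refine homotopic_of_continuous (fun τ γ => ⟨H (τ, γ), hstart _, hend _⟩)
      (Continuous.subtype_mk H.continuous _) ?_ ?_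
    · intro γ
      refine Subtype.ext (ContinuousMap.ext fun t => ?_)
      refine loopFamily_congr _ _ _ _ _ _ _ _ _ _ fun x => ?_
      have hmin : min t 0 = 0 := min_eq_right t.2.1
      have hpath : verticalPath ((g γ).1, x) = linePath (γ, x) := by
        ext s
        rw [verticalPath_apply, hg, linePath_apply]
      change pathLift (linePath (γ, x)) ((γ.1 (min t 0)).1 x : Vec N) 0 t =
        pathLift (verticalPath ((g γ).1, x)) (baseU N) 0 t
      rw [hpath, hmin, γ.2.1]
      rfl
    · intro γ
      refine Subtype.ext (ContinuousMap.ext fun t => ?_)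
      refine loopFamily_eq _ _ _ _ _ fun x => ?_
      have hmin : min t 1 = t := min_eq_left t.2.2
      simp only [W, hmin, ContinuousMap.id_apply]
      refine pathLift_eq_self fun s hs hs' => ?_
      rw [hmin] at hs
      rw [le_antisymm hs' hs, linePath_apply, proj_line]

end Lift

/-! ### Winding numbers -/

section Winding

variable {A : Type*} [TopologicalSpace A]

/-- Families of loops on the circle have continuous angle functions. -/
theorem exists_angle (c : C(A × I, Circle)) (h0 : ∀ a, c (a, 0) = 1) :
    ∃ θ : C(A × I, ℝ), (∀ a, θ (a, 0) = 0) ∧ ∀ p, Circle.exp (θ p) = c p := by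
  have hH : ∀ a : A, (c.comp ContinuousMap.prodSwap) (0, a) =
      Circle.exp ((ContinuousMap.const A (0 : ℝ)) a) := fun a => by
    simpa using h0 a
  refine ⟨(Circle.isCoveringMap_exp.liftHomotopy _ _ hH).comp ContinuousMap.prodSwap, ?_, ?_⟩
  · exact fun a => Circle.isCoveringMap_exp.liftHomotopy_zero _ _ hH a
  · exact fun p => congrFun (Circle.isCoveringMap_exp.liftHomotopy_lifts _ _ hH) p.swap

theorem angle_unique {θ θ' : I → ℝ} (h : Continuous θ) (h' : Continuous θ') (h0 : θ 0 = θ' 0)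
    (he : ∀ x, Circle.exp (θ x) = Circle.exp (θ' x)) : θ = θ' :=
  Circle.isCoveringMap_exp.eq_of_comp_eq h h' (funext he) 0 h0

theorem exists_winding (θ : C(A × I, ℝ)) (h : ∀ a, Circle.exp (θ (a, 1)) = 1) :
    ∃ w : C(A, ℤ), ∀ a, θ (a, 1) = 2 * Real.pi * w a := by
  choose w hw using fun a => Circle.exp_eq_one.mp (h a)
  refine ⟨⟨w, ?_⟩, fun a => (hw a).trans (mul_comm _ _)⟩
  rw [Int.isClosedEmbedding_coe_real.isInducing.continuous_iff]
  have : (Int.cast ∘ w : A → ℝ) = fun a => θ (a, 1) / (2 * Real.pi) := by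
    ext a
    rw [hw, mul_div_cancel_right₀ _ (by positivity)]
    rfl
  rw [this]
  fun_prop

end Winding

/-! ### Relative phases, the winding number over the real projective space, and the degree -/

section Degree

variable {N : ℕ}

/-- Coordinatewise conjugation of vectors. -/
def conjV (v : Vec N) : Vec N := WithLp.toLp 2 fun i => conj (v i)

@[simp]
theorem conjV_apply (v : Vec N) (i : Fin (N + 1)) : conjV v i = conj (v i) := rfl

theorem conjV_ne_zero {v : Vec N} (hv : v ≠ 0) : conjV v ≠ 0 := fun h =>
  hv (PiLp.ext fun i => by simpa using congrFun (congrArg WithLp.ofLp h) i)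

theorem conjCP_lineOf (v : Vec N) (hv : v ≠ 0) :
    conjCP N (lineOf v hv) = lineOf (conjV v) (conjV_ne_zero hv) := rfl

/-- The complex bilinear form `∑ uᵢ vᵢ`. -/
def dot (u v : Vec N) : ℂ := ∑ i, u i * v i

theorem continuous_dot : Continuous fun p : Vec N × Vec N => dot p.1 p.2 := by
  unfold dot
  fun_prop

theorem dot_conjV (u : USph N) : dot (u : Vec N) (conjV u) = 1 := by
  have h := EuclideanSpace.norm_sq_eq (u : Vec N)
  rw [u.norm_eq] at h
  simp only [dot, conjV_apply, Complex.mul_conj, Complex.normSq_eq_norm_sq]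
  rw [← Complex.ofReal_sum, ← h]
  simp

theorem dot_smul (c : ℂ) (u v : Vec N) : dot u (c • v) = c * dot u v := by
  simp only [dot, PiLp.smul_apply, smul_eq_mul, Finset.mul_sum]
  exact Finset.sum_congr rfl fun i _ => by ring

/-- Vectors over conjugate lines satisfy `v = c • conjV u`. Pairing with `u` reads off `c`, because
`dot u (conjV u) = ‖u‖² = 1`; this makes the phase a continuous function of the pair. -/
theorem eq_dot_smul_conjV {u v : USph N} (h : line v = conjCP N (line u)) :
    (v : Vec N) = dot (u : Vec N) v • conjV (u : Vec N) := by
  obtain ⟨a, ha⟩ := (lineOf_eq_iff _ _ _ _).mp (h.trans (conjCP_lineOf _ u.ne_zero))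
  rw [← ha, dot_smul, dot_conjV, mul_one]

theorem norm_conjV (u : Vec N) : ‖conjV u‖ = ‖u‖ := by
  simp [EuclideanSpace.norm_eq]

theorem norm_dot_eq_one {u v : USph N} (h : line v = conjCP N (line u)) :
    ‖dot (u : Vec N) v‖ = 1 := by
  have h1 := congrArg norm (eq_dot_smul_conjV h)
  rw [norm_smul, norm_conjV, u.norm_eq, v.norm_eq, mul_one] at h1
  exact h1.symm

theorem baseU_apply (i : Fin (N + 1)) :
    (baseU N : Vec N) i = ((‖(WithLp.toLp 2 fun _ => 1 : Vec N)‖⁻¹ : ℝ) : ℂ) := by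
  simp [baseU, coe_toUnit]

@[simp]
theorem conjV_baseU : conjV (baseU N : Vec N) = baseU N := by
  ext i
  rw [conjV_apply, baseU_apply, Complex.conj_ofReal]

@[simp]
theorem dot_baseU : dot (baseU N : Vec N) (baseU N : Vec N) = 1 := by
  have := dot_conjV (baseU N)
  rwa [conjV_baseU] at this

/-- Two families of loops on the sphere over conjugate loops in `ℂP^N` have a continuous relative
angle. -/
theorem exists_relative_angle {A : Type*} [TopologicalSpace A] (u v : C(A, ULoop N))
    (h : ∀ a x, line ((v a).1 x) = conjCP N (line ((u a).1 x))) :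
    ∃ θ : C(A × I, ℝ), (∀ a, θ (a, 0) = 0) ∧
      (∀ a x, Complex.exp (θ (a, x) * Complex.I) = dot ((u a).1 x : Vec N) ((v a).1 x)) ∧
      ∃ w : C(A, ℤ), ∀ a, θ (a, 1) = 2 * Real.pi * w a := by
  let c : C(A × I, Circle) :=
    ⟨fun p => ⟨dot ((u p.1).1 p.2 : Vec N) ((v p.1).1 p.2), mem_sphere_zero_iff_norm.mpr
      (norm_dot_eq_one (h _ _))⟩, Continuous.subtype_mk (continuous_dot.comp
        ((continuous_subtype_val.comp (by fun_prop)).prodMk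
          (continuous_subtype_val.comp (by fun_prop)))) _⟩
  have hc : ∀ a x, (c (a, x) : ℂ) = dot ((u a).1 x : Vec N) ((v a).1 x) := fun _ _ => rfl
  obtain ⟨θ, h0, h1⟩ := exists_angle c fun a => Circle.ext (by
    rw [hc, coe_apply_zero, coe_apply_zero, dot_baseU, Circle.coe_one])
  refine ⟨θ, h0, fun a x => ?_, exists_winding θ fun a => ?_⟩
  · rw [← hc, ← h1, Circle.coe_exp]
  · rw [h1]
    exact Circle.ext (by rw [hc, coe_apply_one, coe_apply_one, dot_baseU, Circle.coe_one])

/-- The angle function of loops over `ℝP^N`, with its winding number. -/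
theorem exists_realAngle : ∃ θ : C(realLoops N × I, ℝ), (∀ e, θ (e, 0) = 0) ∧
    (∀ e x, Complex.exp (θ (e, x) * Complex.I) = dot (e.1.1 x : Vec N) (e.1.1 x)) ∧
      ∃ w : C(realLoops N, ℤ), ∀ e, θ (e, 1) = 2 * Real.pi * w e :=
  exists_relative_angle (A := realLoops N) ⟨Subtype.val, continuous_subtype_val⟩
    ⟨Subtype.val, continuous_subtype_val⟩ fun e x => (e.2 x).symm

/-- Twice the phase of a loop over `ℝP^N`. -/
def realAngle : C(realLoops N × I, ℝ) := exists_realAngle.choose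

@[simp]
theorem realAngle_zero (e : realLoops N) : realAngle (e, 0) = 0 :=
  (exists_realAngle (N := N)).choose_spec.1 e

theorem exp_realAngle (e : realLoops N) (x : I) :
    Complex.exp (realAngle (e, x) * Complex.I) = dot (e.1.1 x : Vec N) (e.1.1 x) :=
  (exists_realAngle (N := N)).choose_spec.2.1 e x

/-- The number of half turns of a loop over `ℝP^N`. -/
def realWinding : C(realLoops N, ℤ) := exists_realAngle.choose_spec.2.2.choose

theorem realAngle_one (e : realLoops N) : realAngle (e, 1) = 2 * Real.pi * realWinding e :=
  (exists_realAngle (N := N)).choose_spec.2.2.choose_spec e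

theorem realAngle_unique (e : realLoops N) {θ : I → ℝ} (hθ : Continuous θ) (h0 : θ 0 = 0)
    (h : ∀ x, Complex.exp (θ x * Complex.I) = dot (e.1.1 x : Vec N) (e.1.1 x)) (x : I) :
    realAngle (e, x) = θ x := by
  refine congrFun (angle_unique (θ := fun x => realAngle (e, x)) (by fun_prop) hθ
    (by rw [realAngle_zero, h0]) fun x => Circle.ext ?_) x
  rw [Circle.coe_exp, Circle.coe_exp, exp_realAngle, h]

theorem conjCP_apply_conjS2_infty (f : BasedMap N) :
    conjCP N (f.1 (conjS2 ∞)) = baseCP N := by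
  rw [conjS2_infty, f.2, conjCP_baseCP]

/-- Conjugating a map `S² → ℂP^N` in source and target. -/
def twist : C(BasedMap N, BasedMap N) where
  toFun f := ⟨(⟨conjCP N, continuous_conjCP⟩ : C(CP N, CP N)).comp (f.1.comp conjS2Map),
    conjCP_apply_conjS2_infty f⟩
  continuous_toFun := Continuous.subtype_mk ((ContinuousMap.continuous_postcomp _).comp
    ((ContinuousMap.continuous_precomp _).comp continuous_subtype_val)) _

theorem twist_apply (f : BasedMap N) (x : S2) : (twist f).1 x = conjCP N (f.1 (conjS2 x)) := rfl

theorem twist_eq_self (f : AllEquivariantMaps N) : twist f.1 = f.1 :=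
  Subtype.ext (ContinuousMap.ext fun x => by rw [twist_apply, f.2, conjCP_conjCP])

/-- The loop over `ℝP^N` below the lift of an equivariant map. -/
def boundaryLoop (γ : RealFiber N) : realLoops N := ⟨γ.1 1, γ.2.2⟩

theorem continuous_boundaryLoop : Continuous (boundaryLoop (N := N)) := by
  unfold boundaryLoop
  fun_prop

/-- There is a degree on all based maps that restricts to the winding number on the equivariant
ones. -/
theorem exists_degree : ∃ deg : C(BasedMap N, ℤ), ∀ f : AllEquivariantMaps N,
    deg f.1 = realWinding (boundaryLoop (equivariantLift f)) := by
  let u : C(BasedMap N, ULoop N) := ⟨fun f => upperLift f 1, by fun_prop⟩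
  let v : C(BasedMap N, ULoop N) := ⟨fun f => upperLift (twist f) 1, by fun_prop⟩
  -- The real axis is fixed by conjugation, so there the lifts of `f` and `twist f` lie over
  -- conjugate points. The total turning of their relative phase is the degree. For equivariant `f`
  -- both lifts agree and the relative phase becomes `realAngle`.
  obtain ⟨θ, h0, h1, w, hw⟩ := exists_relative_angle u v fun f x => by
    change line ((upperLift (twist f) 1).1 x) = conjCP N (line ((upperLift f 1).1 x))
    rw [line_upperLift, line_upperLift, twist_apply, conjS2_halfMap_one]
  refine ⟨w, fun f => ?_⟩
  have h : realAngle (boundaryLoop (equivariantLift f), 1) = θ (f.1, 1) := by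
    refine realAngle_unique _ (θ := fun x => θ (f.1, x)) (by fun_prop) (h0 _) (fun x => ?_) 1
    rw [h1]
    change dot ((upperLift f.1 1).1 x : Vec N) ((upperLift (twist f.1) 1).1 x) = _
    rw [twist_eq_self]
    rfl
  rw [realAngle_one, hw] at h
  have := mul_left_cancel₀ (by positivity) h
  exact_mod_cast this.symm

end Degree

/-! ### Loops over `ℝP^N` -/

section RealLoops

variable {N : ℕ}

/-- The real part of a complex vector. -/
def reV (v : Vec N) : EuclideanSpace ℝ (Fin (N + 1)) := WithLp.toLp 2 fun i => (v i).re

/-- A real vector as a complex one. -/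
def cxV (y : EuclideanSpace ℝ (Fin (N + 1))) : Vec N := WithLp.toLp 2 fun i => (y i : ℂ)

theorem continuous_reV : Continuous (reV (N := N)) := by
  unfold reV
  fun_prop

theorem continuous_cxV : Continuous (cxV (N := N)) := by
  unfold cxV
  fun_prop

@[simp]
theorem reV_cxV (y : EuclideanSpace ℝ (Fin (N + 1))) : reV (cxV y) = y := by
  ext i
  simp [reV, cxV]

theorem cxV_reV {v : Vec N} (h : conjV v = v) : cxV (reV v) = v := by
  ext i
  have := congrFun (congrArg WithLp.ofLp h) i
  exact Complex.conj_eq_iff_re.mp this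

@[simp]
theorem conjV_cxV (y : EuclideanSpace ℝ (Fin (N + 1))) : conjV (cxV y) = cxV y := by
  ext i
  simp [cxV]

@[simp]
theorem norm_cxV (y : EuclideanSpace ℝ (Fin (N + 1))) : ‖cxV y‖ = ‖y‖ := by
  simp [EuclideanSpace.norm_eq, cxV]

theorem norm_reV {v : Vec N} (h : conjV v = v) : ‖reV v‖ = ‖v‖ := by
  rw [← norm_cxV, cxV_reV h]

theorem conjV_smul (c : ℂ) (v : Vec N) : conjV (c • v) = conj c • conjV v := by
  ext i
  simp

theorem conj_exp_ofReal_mul_I (t : ℝ) :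
    conj (Complex.exp (t * Complex.I)) = Complex.exp ((-t : ℝ) * Complex.I) := by
  rw [← Complex.exp_conj]
  simp

theorem exp_mul_exp_neg (t : ℝ) :
    Complex.exp (t * Complex.I) * Complex.exp ((-t : ℝ) * Complex.I) = 1 := by
  rw [← Complex.exp_add]
  simp

theorem exp_mul_exp (s t : ℝ) :
    Complex.exp (s * Complex.I) * Complex.exp (t * Complex.I) =
      Complex.exp ((s + t : ℝ) * Complex.I) := by
  rw [← Complex.exp_add]
  congr 1
  push_cast
  ring

/-- A point of a loop over `ℝP^N`, rotated so as to become real. -/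
def realVec (e : realLoops N) (x : I) : Vec N :=
  Complex.exp ((-(realAngle (e, x) / 2) : ℝ) * Complex.I) • (e.1.1 x : Vec N)

/-- Over `ℝP^N` one has `u = exp(iθ) • conjV u`, so rotating `u` by half the angle backwards makes
it self-conjugate. -/
theorem conjV_realVec (e : realLoops N) (x : I) : conjV (realVec e x) = realVec e x := by
  have h1 := eq_dot_smul_conjV (e.2 x).symm
  rw [← exp_realAngle] at h1
  rw [realVec, conjV_smul, conj_exp_ofReal_mul_I]
  conv_rhs => rw [h1]
  rw [smul_smul, exp_mul_exp]
  congr 3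
  push_cast
  ring

theorem smul_realVec (e : realLoops N) (x : I) :
    Complex.exp ((realAngle (e, x) / 2 : ℝ) * Complex.I) • realVec e x = e.1.1 x := by
  rw [realVec, smul_smul, exp_mul_exp_neg, one_smul]

theorem norm_exp_smul (t : ℝ) (v : Vec N) : ‖Complex.exp (t * Complex.I) • v‖ = ‖v‖ := by
  rw [norm_smul, Complex.norm_exp_ofReal_mul_I, one_mul]

theorem norm_realVec (e : realLoops N) (x : I) : ‖realVec e x‖ = 1 := by
  rw [realVec, norm_exp_smul, USph.norm_eq]

theorem continuous_exp_mul_I {A : Type*} [TopologicalSpace A] {f : A → ℝ} (hf : Continuous f) :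
    Continuous fun a => Complex.exp ((f a : ℝ) * Complex.I) :=
  Complex.continuous_exp.comp ((Complex.continuous_ofReal.comp hf).mul continuous_const)

theorem continuous_loop_apply {A : Type*} [TopologicalSpace A] {f : A → realLoops N} {g : A → I}
    (hf : Continuous f) (hg : Continuous g) :
    Continuous fun a => (((f a).1.1 (g a) : USph N) : Vec N) :=
  continuous_subtype_val.comp (by fun_prop)

theorem continuous_realVec : Continuous fun p : realLoops N × I => realVec p.1 p.2 := by
  refine Continuous.smul (M := ℂ) (continuous_exp_mul_I ?_) ?_
  · exact (realAngle.continuous.div_const 2).neg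
  · exact continuous_loop_apply continuous_fst continuous_snd

/-- The loops over `ℝP^N` with given winding number. -/
def realLoopsWith (N : ℕ) (k : ℤ) : Set (ULoop N) :=
  {e | ∃ h : e ∈ realLoops N, realWinding ⟨e, h⟩ = k}

/-- The underlying loop over `ℝP^N`. -/
def toRealLoop (k : ℤ) : C(realLoopsWith N k, realLoops N) :=
  ⟨fun e => ⟨e.1, e.2.choose⟩, by fun_prop⟩

theorem realWinding_toRealLoop {k : ℤ} (e : realLoopsWith N k) :
    realWinding (toRealLoop k e) = k := e.2.choose_spec

theorem toRealLoop_coe {k : ℤ} (e : realLoopsWith N k) : (toRealLoop k e).1 = e.1 := rfl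

/-- Multiplication of the base vector by `(-1)^k`. -/
def endVec (N : ℕ) (k : ℤ) : Vec N :=
  Complex.exp ((-(Real.pi * k) : ℝ) * Complex.I) • (baseU N : Vec N)

theorem exp_neg_pi_mul_int (k : ℤ) :
    Complex.exp ((-(Real.pi * k) : ℝ) * Complex.I) = Complex.exp ((Real.pi * k : ℝ) * Complex.I) := by
  rw [Complex.exp_eq_exp_iff_exists_int]
  refine ⟨-k, ?_⟩
  push_cast
  ring

@[simp]
theorem conjV_endVec (k : ℤ) : conjV (endVec N k) = endVec N k := by
  rw [endVec, conjV_smul, conj_exp_ofReal_mul_I, conjV_baseU, neg_neg, exp_neg_pi_mul_int]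

theorem smul_endVec (k : ℤ) :
    Complex.exp ((Real.pi * k : ℝ) * Complex.I) • endVec N k = baseU N := by
  rw [endVec, smul_smul, exp_mul_exp_neg, one_smul]

/-- The point `(-1)^k` times the base point of the real sphere. -/
def endR (N : ℕ) (k : ℤ) : Sph N := ⟨reV (endVec N k), by
  rw [mem_sphere_zero_iff_norm, norm_reV (conjV_endVec k), endVec, norm_exp_smul, USph.norm_eq]⟩

/-- The base point of the real sphere. -/
def baseR (N : ℕ) : Sph N := ⟨reV (baseU N : Vec N), by
  rw [mem_sphere_zero_iff_norm, norm_reV conjV_baseU, USph.norm_eq]⟩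

theorem realVec_zero (e : realLoops N) : realVec e 0 = baseU N := by
  rw [realVec, realAngle_zero, coe_apply_zero]
  simp

theorem realVec_one {k : ℤ} (e : realLoopsWith N k) :
    realVec (toRealLoop k e) 1 = endVec N k := by
  rw [realVec, realAngle_one, coe_apply_one, realWinding_toRealLoop, endVec]
  congr 4
  ring

/-- A point of a loop over `ℝP^N`, rotated so as to become real, as a point of the real sphere. -/
def realPoint (p : realLoops N × I) : Sph N := ⟨reV (realVec p.1 p.2), by
  rw [mem_sphere_zero_iff_norm, norm_reV (conjV_realVec _ _), norm_realVec]⟩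

theorem coe_realPoint (p : realLoops N × I) :
    (realPoint p : EuclideanSpace ℝ (Fin (N + 1))) = reV (realVec p.1 p.2) := rfl

theorem continuous_realPoint : Continuous (realPoint (N := N)) :=
  Continuous.subtype_mk (continuous_reV.comp continuous_realVec) _

theorem realPoint_zero (e : realLoops N) : realPoint (e, 0) = baseR N :=
  Subtype.ext (by rw [coe_realPoint, realVec_zero]; rfl)

theorem realPoint_one {k : ℤ} (e : realLoopsWith N k) :
    realPoint (toRealLoop k e, 1) = endR N k :=
  Subtype.ext (by rw [coe_realPoint, realVec_one]; rfl)

/-- The real path of a loop over `ℝP^N`. -/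
def realPath (k : ℤ) : C(realLoopsWith N k, PathsInto (baseR N) {endR N k}) where
  toFun e := ⟨⟨fun x => realPoint (toRealLoop k e, x), continuous_realPoint.comp (by fun_prop)⟩,
    realPoint_zero _, realPoint_one _⟩
  continuous_toFun := by
    refine Continuous.subtype_mk (continuous_into_continuousMap ?_) _
    have h : Continuous fun p : realLoopsWith N k × I => (toRealLoop k p.1, p.2) := by fun_prop
    exact continuous_realPoint.comp h

theorem realPath_apply (k : ℤ) (e : realLoopsWith N k) (x : I) :
    ((realPath k e).1 x : EuclideanSpace ℝ (Fin (N + 1))) = reV (realVec (toRealLoop k e) x) := rfl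

/-- A family of loops on the sphere from a family of unit vectors. -/
def unitFamily {A : Type*} [TopologicalSpace A] (W : A → I → Vec N)
    (hW : Continuous fun q : A × I => W q.1 q.2) (hn : ∀ a x, ‖W a x‖ = 1)
    (h0 : ∀ a, W a 0 = baseU N) (h1 : ∀ a, W a 1 = baseU N) : C(A, ULoop N) where
  toFun a := ⟨⟨fun x => ⟨W a x, mem_sphere_zero_iff_norm.mpr (hn a x)⟩,
    Continuous.subtype_mk (hW.comp (by fun_prop : Continuous fun x : I => (a, x))) _⟩,
    Subtype.ext (h0 a), Subtype.ext (h1 a)⟩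
  continuous_toFun := Continuous.subtype_mk (continuous_into_continuousMap
    (Continuous.subtype_mk hW _)) _

theorem uloop_ext {e e' : ULoop N} (h : ∀ x, (e.1 x : Vec N) = e'.1 x) : e = e' :=
  Subtype.ext (ContinuousMap.ext fun x => Subtype.ext (h x))

theorem line_eq_of_smul {u v : USph N} (c : ℂ) (h : (v : Vec N) = c • (u : Vec N)) :
    line v = line u :=
  (lineOf_eq_iff _ _ _ _).mpr ⟨c, h.symm⟩

theorem dot_smul_smul (c : ℂ) (u : Vec N) : dot (c • u) (c • u) = c * c * dot u u := by
  simp only [dot, PiLp.smul_apply, smul_eq_mul, Finset.mul_sum]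
  exact Finset.sum_congr rfl fun i _ => by ring

theorem dot_cxV (y : Sph N) :
    dot (cxV (y : EuclideanSpace ℝ (Fin (N + 1)))) (cxV (y : EuclideanSpace ℝ (Fin (N + 1)))) = 1 := by
  have h := dot_conjV (⟨cxV (y : EuclideanSpace ℝ (Fin (N + 1))), by
    rw [mem_sphere_zero_iff_norm, norm_cxV, norm_eq_of_mem_sphere]⟩ : USph N)
  rwa [conjV_cxV] at h

/-- A real vector rotated by a multiple of a half turn. -/
def rotVec (k : ℤ) (x : I) (y : EuclideanSpace ℝ (Fin (N + 1))) : Vec N :=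
  Complex.exp ((Real.pi * k * x : ℝ) * Complex.I) • cxV y

theorem continuous_rotVec (k : ℤ) :
    Continuous fun q : PathsInto (baseR N) {endR N k} × I =>
      rotVec k q.2 (q.1.1 q.2 : EuclideanSpace ℝ (Fin (N + 1))) := by
  have h : Continuous fun q : PathsInto (baseR N) {endR N k} × I =>
      (q.1.1 q.2 : EuclideanSpace ℝ (Fin (N + 1))) := continuous_subtype_val.comp (by fun_prop)
  exact (continuous_exp_mul_I (by fun_prop)).smul (continuous_cxV.comp h)

/-- Closing up a real path from the base point to `(-1)^k` times the base point by a rotation. -/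
def rotLoop (k : ℤ) : C(PathsInto (baseR N) {endR N k}, ULoop N) :=
  unitFamily (fun r x => rotVec k x (r.1 x : EuclideanSpace ℝ (Fin (N + 1)))) (continuous_rotVec k)
    (fun r x => by rw [rotVec, norm_exp_smul, norm_cxV, norm_eq_of_mem_sphere])
    (fun r => by
      rw [r.2.1, rotVec, baseR, cxV_reV conjV_baseU]
      simp)
    (fun r => by
      rw [show r.1 1 = endR N k from r.2.2, rotVec, endR, cxV_reV (conjV_endVec k),
        Set.Icc.coe_one, mul_one, smul_endVec])

theorem coe_rotLoop (k : ℤ) (r : PathsInto (baseR N) {endR N k}) (x : I) :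
    ((rotLoop k r).1 x : Vec N) = rotVec k x (r.1 x : EuclideanSpace ℝ (Fin (N + 1))) := rfl

theorem rotLoop_mem (k : ℤ) (r : PathsInto (baseR N) {endR N k}) : rotLoop k r ∈ realLoops N := by
  intro x
  rw [line, conjCP_lineOf, lineOf_eq_iff]
  refine ⟨Complex.exp ((-(2 * (Real.pi * k * x)) : ℝ) * Complex.I), ?_⟩
  rw [coe_rotLoop, rotVec, conjV_smul, conjV_cxV, conj_exp_ofReal_mul_I, smul_smul, exp_mul_exp]
  congr 3
  push_cast
  ring

theorem realAngle_rotLoop (k : ℤ) (r : PathsInto (baseR N) {endR N k}) (x : I) :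
    realAngle (⟨rotLoop k r, rotLoop_mem k r⟩, x) = 2 * (Real.pi * k * x) := by
  refine realAngle_unique _ (θ := fun x : I => 2 * (Real.pi * k * x)) (by fun_prop) (by simp)
    (fun x => ?_) x
  rw [coe_rotLoop, rotVec, dot_smul_smul, dot_cxV, mul_one, exp_mul_exp, ← two_mul]

theorem rotLoop_mem_realLoopsWith (k : ℤ) (r : PathsInto (baseR N) {endR N k}) :
    rotLoop k r ∈ realLoopsWith N k := by
  refine ⟨rotLoop_mem k r, ?_⟩
  have h1 := realAngle_one ⟨rotLoop k r, rotLoop_mem k r⟩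
  rw [realAngle_rotLoop, Set.Icc.coe_one, mul_one, ← mul_assoc] at h1
  have h2 := mul_left_cancel₀ (by positivity) h1
  exact_mod_cast h2.symm

/-- Real paths as loops over `ℝP^N`. -/
def rotRealLoop (k : ℤ) : C(PathsInto (baseR N) {endR N k}, realLoopsWith N k) :=
  ⟨fun r => ⟨rotLoop k r, rotLoop_mem_realLoopsWith k r⟩, by fun_prop⟩

/-- The phase of a rotated real path is exactly `πkx`, so on this side the two constructions are
strictly inverse and no homotopy is needed. -/
theorem realPath_rotRealLoop (k : ℤ) (r : PathsInto (baseR N) {endR N k}) :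
    realPath k (rotRealLoop k r) = r := by
  refine Subtype.ext (ContinuousMap.ext fun x => Subtype.ext ?_)
  have h1 : toRealLoop k (rotRealLoop k r) = ⟨rotLoop k r, rotLoop_mem k r⟩ := rfl
  rw [realPath_apply, h1, realVec, realAngle_rotLoop, coe_rotLoop, rotVec, smul_smul, exp_mul_exp]
  rw [show -(2 * (Real.pi * k * x) / 2) + Real.pi * k * x = 0 by ring]
  simp

/-- A loop over `ℝP^N` rotated by a real multiple of the difference of its phase to the standard
one. -/
def phaseVec (k : ℤ) (q : I × realLoopsWith N k) (x : I) : Vec N :=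
  Complex.exp (((1 - (q.1 : ℝ)) * (Real.pi * k * x - realAngle (toRealLoop k q.2, x) / 2) : ℝ)
    * Complex.I) • (q.2.1.1 x : Vec N)

theorem continuous_phaseVec (k : ℤ) :
    Continuous fun q : (I × realLoopsWith N k) × I => phaseVec k q.1 q.2 := by
  have h : Continuous fun q : (I × realLoopsWith N k) × I => (q.1.2.1.1 q.2 : Vec N) :=
    continuous_subtype_val.comp (by fun_prop)
  exact (continuous_exp_mul_I (by fun_prop)).smul h

/-- The deformation of the phase of a loop over `ℝP^N` to the standard one. -/
def phaseLoop (k : ℤ) : C(I × realLoopsWith N k, ULoop N) :=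
  unitFamily (phaseVec k) (continuous_phaseVec k)
    (fun q x => by rw [phaseVec, norm_exp_smul, USph.norm_eq])
    (fun q => by
      rw [phaseVec, coe_apply_zero, realAngle_zero]
      simp)
    (fun q => by
      -- Winding number `k` means that half the angle ends at `πk`, so the phase difference vanishes
      -- at the end and the deformed loop stays closed.
      rw [phaseVec, coe_apply_one, realAngle_one, realWinding_toRealLoop, Set.Icc.coe_one,
        show (1 - (q.1 : ℝ)) * (Real.pi * k * 1 - 2 * Real.pi * k / 2) = 0 by ring]
      simp)

theorem coe_phaseLoop (k : ℤ) (q : I × realLoopsWith N k) (x : I) :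
    ((phaseLoop k q).1 x : Vec N) = phaseVec k q x := rfl

theorem phaseLoop_mem (k : ℤ) (q : I × realLoopsWith N k) : phaseLoop k q ∈ realLoops N := by
  intro x
  rw [line_eq_of_smul (u := q.2.1.1 x) _ (coe_phaseLoop k q x)]
  exact q.2.2.choose x

theorem phaseLoop_one (k : ℤ) (e : realLoopsWith N k) : phaseLoop k (1, e) = e.1 :=
  uloop_ext fun x => by
    rw [coe_phaseLoop]
    simp [phaseVec]

theorem phaseLoop_zero (k : ℤ) (e : realLoopsWith N k) :
    phaseLoop k (0, e) = rotLoop k (realPath k e) :=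
  uloop_ext fun x => by
    rw [coe_phaseLoop, phaseVec, coe_rotLoop, rotVec, realPath_apply, cxV_reV (conjV_realVec _ _),
      realVec, smul_smul, exp_mul_exp, toRealLoop_coe]
    congr 4
    simp
    ring

/-- The winding number is integer-valued and continuous in `s`, and at `s = 1` the loop is the
original one. -/
theorem phaseLoop_mem_realLoopsWith (k : ℤ) (s : I) (e : realLoopsWith N k) :
    phaseLoop k (s, e) ∈ realLoopsWith N k := by
  refine ⟨phaseLoop_mem k (s, e), ?_⟩
  let H : C(I × realLoopsWith N k, realLoops N) :=
    ⟨fun q => ⟨phaseLoop k q, phaseLoop_mem k q⟩, by fun_prop⟩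
  have h1 : realWinding (H (1, e)) = k :=
    (congrArg realWinding (Subtype.ext (phaseLoop_one k e))).trans (realWinding_toRealLoop e)
  refine Eq.trans ?_ h1
  exact PreconnectedSpace.constant (α := I) (f := fun s => realWinding (H (s, e)))
    inferInstance (by fun_prop)

/-- Loops over `ℝP^N` of winding number `k` are, up to homotopy, real paths from the base point to
`(-1)^k` times the base point. -/
def realLoopsWithHomotopyEquiv (k : ℤ) :
    realLoopsWith N k ≃ₕ PathsInto (baseR N) {endR N k} where
  toFun := realPath k
  invFun := rotRealLoop k
  left_inv := homotopic_of_continuous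
    (fun s e => ⟨phaseLoop k (s, e), phaseLoop_mem_realLoopsWith k s e⟩)
    (Continuous.subtype_mk (phaseLoop k).continuous _)
    (fun e => Subtype.ext (phaseLoop_zero k e)) fun e => Subtype.ext (phaseLoop_one k e)
  right_inv := by
    rw [show (realPath k).comp (rotRealLoop k) = ContinuousMap.id (PathsInto (baseR N) {endR N k})
      from ContinuousMap.ext (realPath_rotRealLoop k)]

/-- The inclusion of the loops over `ℝP^N` is null-homotopic. -/
theorem homotopic_realLoopsWith (hN : 1 ≤ N) (k : ℤ) :
    ContinuousMap.Homotopic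
      (⟨Subtype.val, continuous_subtype_val⟩ : C(realLoopsWith N k, ULoop N))
      (ContinuousMap.const _ (constLoop (baseU N))) := by
  -- A real vector `a` and a linear functional `φ` that is real on real vectors, kills the base
  -- vector and has `φ a = 2`. They exist because `N ≥ 1` gives two different coordinates.
  let a : Vec N := EuclideanSpace.single 0 1 - EuclideanSpace.single (Fin.last N) 1
  let φ : Vec N → ℂ := fun v => v 0 - v (Fin.last N)
  have hlast : (0 : Fin (N + 1)) ≠ Fin.last N := by
    rw [Ne, Fin.ext_iff]
    simp
    omega
  have hφa : φ a = 2 := by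
    simp [φ, a, hlast, hlast.symm]
    norm_num
  have hφadd : ∀ u v, φ (u + v) = φ u + φ v := fun u v => by simp only [φ, PiLp.add_apply]; ring
  have hφsmul : ∀ (c : ℂ) u, φ (c • u) = c * φ u := fun c u => by
    simp only [φ, PiLp.smul_apply, smul_eq_mul]; ring
  have hφbase : φ (baseU N : Vec N) = 0 := by simp only [φ, baseU_apply, sub_self]
  have hφreal : ∀ u, conjV u = u → (φ u).im = 0 := fun u hu => by
    have h1 := cxV_reV hu
    rw [← h1]
    simp [φ, cxV]
  -- The segment from the loop to the base vector could pass through zero; it is pushed off in the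
  -- direction `i exp(iθ/2) a`. The weight vanishes for `t` and `x` in `{0, 1}`, so the ends of the
  -- homotopy and the base points are untouched.
  let W : realLoopsWith N k → I → I → Vec N := fun e t x =>
    (1 - (t : ℝ) : ℂ) • (e.1.1 x : Vec N) + (t : ℂ) • (baseU N : Vec N) +
      ((t * (1 - t) * (x * (1 - x)) : ℝ) : ℂ) • Complex.I •
        Complex.exp ((realAngle (toRealLoop k e, x) / 2 : ℝ) * Complex.I) • a
  have hW : Continuous fun q : (realLoopsWith N k × I) × I => W q.1.1 q.1.2 q.2 := by
    have h1 : Continuous fun q : (realLoopsWith N k × I) × I => (q.1.1.1.1 q.2 : Vec N) :=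
      continuous_subtype_val.comp (by fun_prop)
    have h2 : Continuous fun q : (realLoopsWith N k × I) × I =>
        Complex.exp ((realAngle (toRealLoop k q.1.1, q.2) / 2 : ℝ) * Complex.I) :=
      continuous_exp_mul_I (by fun_prop)
    have h3 : Continuous fun q : (realLoopsWith N k × I) × I => ((q.1.2 : ℝ) : ℂ) := by fun_prop
    have h4 : Continuous fun q : (realLoopsWith N k × I) × I =>
      ((q.1.2 * (1 - q.1.2) * (q.2 * (1 - q.2)) : ℝ) : ℂ) :=
      Complex.continuous_ofReal.comp (by fun_prop)
    exact (((continuous_const.sub h3).smul h1).add (h3.smul continuous_const)).add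
      (h4.smul ((h2.smul continuous_const).const_smul Complex.I))
  have hbase : ∀ (t : I), (1 - (t : ℝ) : ℂ) • (baseU N : Vec N) + (t : ℂ) • (baseU N : Vec N) =
      baseU N := fun t => by
    rw [← add_smul, sub_add_cancel, one_smul]
  have h0 : ∀ e t, W e t 0 = baseU N := fun e t => by
    simp only [W, coe_apply_zero, hbase]
    simp
  have h1 : ∀ e t, W e t 1 = baseU N := fun e t => by
    simp only [W, coe_apply_one, hbase]
    simp
  have hz : ∀ e x, W e 0 x = e.1.1 x := fun e x => by simp [W]
  have ho : ∀ e x, W e 1 x = baseU N := fun e x => by simp [W]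
  have hne : ∀ e t x, W e t x ≠ 0 := by
    intro e t x hWz
    -- Rotate by `exp(-iθ/2)` and apply `φ`: the loop contributes a real number, the base vector
    -- nothing, and the correction twice its weight times `i`. A zero of `W` thus forces the weight
    -- to vanish, and there `W` is a unit vector.
    have key : (t : ℝ) * (1 - t) * (x * (1 - x)) = 0 := by
      have h2 := congrArg φ (congrArg
        (Complex.exp ((-(realAngle (toRealLoop k e, x) / 2) : ℝ) * Complex.I) • ·) hWz)
      have h3 : (e.1.1 x : Vec N) = _ := (smul_realVec (toRealLoop k e) x).symm
      have h4 : φ 0 = 0 := by simp [φ]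
      have h5 := exp_mul_exp_neg (realAngle (toRealLoop k e, x) / 2)
      simp only [W, hφsmul, hφadd, hφbase, hφa, smul_zero, h4, h3, mul_zero, add_zero] at h2
      have h6 := congrArg Complex.im h2
      have h7 := hφreal _ (conjV_realVec (toRealLoop k e) x)
      generalize φ (realVec (toRealLoop k e) x) = z at *
      generalize Complex.exp ((realAngle (toRealLoop k e, x) / 2 : ℝ) * Complex.I) = c at *
      generalize Complex.exp ((-(realAngle (toRealLoop k e, x) / 2) : ℝ) * Complex.I) = c' at *
      have h8 : c' * ((1 - (t : ℝ)) * (c * z) + ((t * (1 - t) * (x * (1 - x)) : ℝ) : ℂ) *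
          (Complex.I * (c * 2))) = ((1 - t : ℝ) : ℂ) * z +
          ((t * (1 - t) * (x * (1 - x)) : ℝ) : ℂ) * (Complex.I * 2) := by
        push_cast
        linear_combination ((1 - (t : ℂ)) * z +
          ((t * (1 - t) * (x * (1 - x)))) * (Complex.I * 2)) * h5
      rw [h8, Complex.add_im, Complex.im_ofReal_mul, Complex.im_ofReal_mul, h7] at h6
      simpa using h6
    rcases mul_eq_zero.mp key with h | h <;> rcases mul_eq_zero.mp h with h | h
    · rw [show t = 0 from Subtype.ext h, hz] at hWz
      exact USph.ne_zero _ hWz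
    · rw [show t = 1 from Subtype.ext (by simpa using (sub_eq_zero.mp h).symm), ho] at hWz
      exact USph.ne_zero _ hWz
    · rw [show x = 0 from Subtype.ext h, h0] at hWz
      exact USph.ne_zero _ hWz
    · rw [show x = 1 from Subtype.ext (by simpa using (sub_eq_zero.mp h).symm), h1] at hWz
      exact USph.ne_zero _ hWz
  let F := loopFamily W hW hne h0 h1
  refine homotopic_of_continuous (fun t e => F e t) (by fun_prop) ?_ ?_
  · exact fun e => loopFamily_eq _ _ _ _ _ (hz e)
  · exact fun e => loopFamily_eq _ _ _ _ _ (ho e)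

end RealLoops

/-! ### Maps from low dimensional spaces to spheres are null-homotopic -/

section Connectivity

variable {K V : Type*} [TopologicalSpace K] [NormedAddCommGroup V]
  [NormedSpace ℝ V]

/-- The functions on `K ⊆ V` that extend to smooth functions on `V`. -/
def smoothSubalgebra (ι : C(K, V)) : Subalgebra ℝ C(K, ℝ) where
  carrier := {g | ∃ φ : V → ℝ, ContDiff ℝ 1 φ ∧ ∀ x, g x = φ (ι x)}
  mul_mem' := by
    rintro a b ⟨φ, hφ, h⟩ ⟨ψ, hψ, h'⟩
    exact ⟨φ * ψ, hφ.mul hψ, fun x => by simp [h, h']⟩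
  add_mem' := by
    rintro a b ⟨φ, hφ, h⟩ ⟨ψ, hψ, h'⟩
    exact ⟨φ + ψ, hφ.add hψ, fun x => by simp [h, h']⟩
  algebraMap_mem' r := ⟨fun _ => r, contDiff_const, fun x => rfl⟩

theorem separatesPoints_smoothSubalgebra (ι : C(K, V)) (hι : Function.Injective ι) :
    (smoothSubalgebra ι).SeparatesPoints := by
  intro x y hxy
  obtain ⟨φ, hφ⟩ := SeparatingDual.exists_separating_of_ne (R := ℝ) (hι.ne hxy)
  exact ⟨_, ⟨⟨fun x => φ (ι x), by fun_prop⟩, ⟨φ, φ.contDiff, fun _ => rfl⟩, rfl⟩, hφ⟩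

/-- Stone–Weierstrass in each coordinate; continuous linear functionals already separate points. The
norm is bounded by the sum of the coordinates, and `n + 1` in place of `n` also covers `n = 0`. -/
theorem exists_smooth_near [CompactSpace K] (ι : C(K, V)) (hι : Function.Injective ι) {n : ℕ}
    (f : C(K, EuclideanSpace ℝ (Fin n))) {ε : ℝ} (hε : 0 < ε) :
    ∃ P : V → EuclideanSpace ℝ (Fin n), ContDiff ℝ 1 P ∧ ∀ x, ‖P (ι x) - f x‖ < ε := by
  have hδ : 0 < ε / (n + 1) := by positivity
  have h : ∀ i : Fin n, ∃ φ : V → ℝ, ContDiff ℝ 1 φ ∧ ∀ x, ‖φ (ι x) - f x i‖ < ε / (n + 1) := by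
    intro i
    let F : C(K, ℝ) := ⟨fun x => f x i, by fun_prop⟩
    obtain ⟨⟨g, φ, hφ, hg⟩, hgf⟩ :=
      ContinuousMap.exists_mem_subalgebra_near_continuousMap_of_separatesPoints
        (smoothSubalgebra ι) (separatesPoints_smoothSubalgebra ι hι) F _ hδ
    refine ⟨φ, hφ, fun x => ?_⟩
    have h1 : ‖(g - F) x‖ < ε / (n + 1) := (ContinuousMap.norm_coe_le_norm (g - F) x).trans_lt hgf
    rw [ContinuousMap.sub_apply, hg] at h1
    exact h1
  choose φ hφ hφf using h
  refine ⟨fun y => WithLp.toLp 2 fun i => φ i y, ?_, fun x => ?_⟩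
  · exact contDiff_euclidean.mpr fun i => hφ i
  · have hsum : ∀ v : EuclideanSpace ℝ (Fin n), ‖v‖ ≤ ∑ i, ‖v i‖ := by
      intro v
      conv_lhs => rw [← (EuclideanSpace.basisFun (Fin n) ℝ).sum_repr v]
      refine (norm_sum_le _ _).trans (Finset.sum_le_sum fun i _ => ?_)
      rw [norm_smul, OrthonormalBasis.norm_eq_one, mul_one]
      rfl
    refine (hsum _).trans_lt ?_
    refine (Finset.sum_le_sum fun i _ => (hφf i x).le).trans_lt ?_
    rw [Finset.sum_const, Finset.card_univ, Fintype.card_fin, nsmul_eq_mul, mul_div_assoc',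
      div_lt_iff₀ (by positivity)]
    nlinarith

/-- Smooth approximation relative to a point inverse. -/
theorem exists_smooth_near_rel [CompactSpace K] (ι : C(K, V)) (hι : Function.Injective ι) {n : ℕ}
    (f : C(K, EuclideanSpace ℝ (Fin n))) (p : EuclideanSpace ℝ (Fin n)) {ε : ℝ} (hε : 0 < ε) :
    ∃ P : V → EuclideanSpace ℝ (Fin n), ContDiff ℝ 1 P ∧ (∀ x, ‖P (ι x) - f x‖ < ε) ∧
      ∀ x, f x = p → P (ι x) = p := by
  obtain ⟨P, hP, hPf⟩ := exists_smooth_near ι hι f (by positivity : 0 < ε / 3)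
  -- A smooth cut-off that is `0` where `‖P - p‖ ≤ ε/3` and `1` where `‖P - p‖² ≥ 2(ε/3)²`. Scaling
  -- `P - p` by it collapses to `p` every value near a point with `f x = p`, and moves no value by
  -- more than `2ε/3`.
  let τ : V → ℝ := fun y => Real.smoothTransition ((‖P y - p‖ ^ 2 - (ε / 3) ^ 2) / (ε / 3) ^ 2)
  have hτ : ContDiff ℝ 1 τ := by
    refine Real.smoothTransition.contDiff.comp ?_
    exact (((hP.sub contDiff_const).norm_sq ℝ).sub contDiff_const).div_const _
  have h0 : ∀ y, 0 ≤ τ y := fun y => Real.smoothTransition.nonneg _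
  have h1 : ∀ y, τ y ≤ 1 := fun y => Real.smoothTransition.le_one _
  refine ⟨fun y => p + τ y • (P y - p), ?_, fun x => ?_, fun x hx => ?_⟩
  · exact contDiff_const.add (hτ.smul (hP.sub contDiff_const))
  · have h2 : ‖(p + τ (ι x) • (P (ι x) - p)) - P (ι x)‖ ≤ 2 * (ε / 3) := by
      rw [show (p + τ (ι x) • (P (ι x) - p)) - P (ι x) = (τ (ι x) - 1) • (P (ι x) - p) by module,
        norm_smul, Real.norm_eq_abs, abs_of_nonpos (by linarith [h1 (ι x)])]
      by_cases hc : (ε / 3) ^ 2 * 2 ≤ ‖P (ι x) - p‖ ^ 2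
      · have : τ (ι x) = 1 := Real.smoothTransition.one_of_one_le (by
          rw [le_div_iff₀ (by positivity)]
          linarith)
        rw [this]
        simp only [sub_self, neg_zero, zero_mul]
        positivity
      · have h3 : ‖P (ι x) - p‖ ≤ 2 * (ε / 3) := by
          refine abs_le_of_sq_le_sq' ?_ (by positivity) |>.2
          nlinarith [sq_nonneg (ε / 3)]
        have h4 : -(τ (ι x) - 1) ≤ 1 := by linarith [h0 (ι x)]
        calc -(τ (ι x) - 1) * ‖P (ι x) - p‖ ≤ 1 * ‖P (ι x) - p‖ :=
              mul_le_mul_of_nonneg_right h4 (norm_nonneg _)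
          _ ≤ _ := by rw [one_mul]; exact h3
    calc _ ≤ ‖(p + τ (ι x) • (P (ι x) - p)) - P (ι x)‖ + ‖P (ι x) - f x‖ :=
          norm_sub_le_norm_sub_add_norm_sub _ _ _
      _ < ε := by linarith [hPf x]
  · have h2 : ‖P (ι x) - p‖ < ε / 3 := hx ▸ hPf x
    have : τ (ι x) = 0 := Real.smoothTransition.zero_of_nonpos (by
      refine div_nonpos_of_nonpos_of_nonneg ?_ (by positivity)
      nlinarith [norm_nonneg (P (ι x) - p)])
    simp [this]

/-- A `C¹` map from a low dimensional space to a vector space misses a direction. -/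
theorem exists_direction_avoided [FiniteDimensional ℝ V] {m : ℕ} (hm : Module.finrank ℝ V < m)
    (g : V → EuclideanSpace ℝ (Fin (m + 1))) (hg : ContDiff ℝ 1 g) :
    ∃ u : Sph m, ∀ y (c : ℝ), c • g y ≠ u := by
  -- The cone over the image is a `C¹` image of `ℝ × V`, whose dimension is below `m + 1`; by Sard
  -- its complement is dense. A vector outside, normalised, is the missed direction.
  have hd : ContDiff ℝ 1 fun q : ℝ × V => q.1 • g q.2 :=
    contDiff_fst.smul (hg.comp contDiff_snd)
  have hdense := hd.dense_compl_range_of_finrank_lt_finrank (by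
    rw [Module.finrank_prod, Module.finrank_self, finrank_euclideanSpace_fin]
    omega)
  obtain ⟨u, hu⟩ := hdense.nonempty
  have hu0 : u ≠ 0 := by
    rintro rfl
    exact hu ⟨(0, 0), by simp⟩
  refine ⟨⟨‖u‖⁻¹ • u, by simp [norm_smul, hu0]⟩, fun y c h => hu ⟨(‖u‖ * c, y), ?_⟩⟩
  change (‖u‖ * c) • g y = u
  rw [mul_smul, h, smul_smul, mul_inv_cancel₀ (norm_ne_zero_iff.mpr hu0), one_smul]

/-- A map to a sphere that misses a point is null-homotopic, relative to any point inverse. -/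
theorem homotopicRel_const_of_avoids {m : ℕ} (p : Sph m) (f : C(K, Sph m)) {A : Set K}
    (hA : A.Nonempty) (hf : ∀ x ∈ A, f x = p) (u : Sph m) (hu : ∀ x, f x ≠ u) :
    f.HomotopicRel (ContinuousMap.const K p) A := by
  have hu1 : ‖(u : EuclideanSpace ℝ (Fin (m + 1)))‖ = 1 := norm_eq_of_mem_sphere u
  let st := stereographic hu1
  have hsrc : ∀ w : Sph m, w ≠ u → w ∈ st.source := fun w hw => by
    rw [stereographic_source]
    exact hw
  have htgt : ∀ z, z ∈ st.target := fun z => by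
    rw [stereographic_target]
    trivial
  have hp : p ≠ u := by
    obtain ⟨a, ha⟩ := hA
    rw [← hf a ha]
    exact hu a
  have hst : Continuous fun x => st (f x) :=
    st.continuousOn.comp_continuous f.continuous fun x => hsrc _ (hu x)
  have hsymm : Continuous st.symm := by
    rw [← continuousOn_univ]
    exact st.symm.continuousOn.mono fun z _ => htgt z
  -- A straight-line homotopy in the stereographic chart from the missed point. It is stationary
  -- wherever `f` already equals `p`.
  refine ⟨⟨⟨⟨fun q : I × K => st.symm ((1 - (q.1 : ℝ)) • st (f q.2) + (q.1 : ℝ) • st p), ?_⟩,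
    fun x => ?_, fun x => ?_⟩, fun t x hx => ?_⟩⟩
  · exact hsymm.comp (((by fun_prop : Continuous fun q : I × K => (1 - (q.1 : ℝ))).smul
      (hst.comp continuous_snd)).add
        ((by fun_prop : Continuous fun q : I × K => (q.1 : ℝ)).smul continuous_const))
  · simp [st.left_inv (hsrc _ (hu x))]
  · simp [st.left_inv (hsrc _ hp)]
  · change st.symm ((1 - (t : ℝ)) • st (f x) + (t : ℝ) • st p) = f x
    rw [hf x hx, ← add_smul, sub_add_cancel, one_smul, st.left_inv (hsrc _ hp)]

/-- Nearby maps to the sphere are homotopic relative to the set where they agree. -/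
theorem homotopicRel_of_near {m : ℕ} (f : C(K, Sph m))
    (g : C(K, EuclideanSpace ℝ (Fin (m + 1))))
    (hgf : ∀ x, ‖g x - f x‖ < 1) {A : Set K} (hA : ∀ x ∈ A, g x = f x) :
    ∃ h : C(K, Sph m), f.HomotopicRel h A ∧
      ∀ x, ∃ c : ℝ, (h x : EuclideanSpace ℝ (Fin (m + 1))) = c • g x := by
  let W : I × K → EuclideanSpace ℝ (Fin (m + 1)) := fun q =>
    (f q.2 : EuclideanSpace ℝ (Fin (m + 1))) + (q.1 : ℝ) • (g q.2 - f q.2)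
  have hW : Continuous W := by
    have hf : Continuous fun q : I × K => (f q.2 : EuclideanSpace ℝ (Fin (m + 1))) :=
      continuous_subtype_val.comp (by fun_prop)
    fun_prop
  -- The segment starts at a unit vector and has length less than `1`, so it can be normalised to
  -- the sphere.
  have hne : ∀ q, W q ≠ 0 := by
    intro q h0
    have h1 : ‖(q.1 : ℝ) • (g q.2 - f q.2)‖ < 1 := by
      rw [norm_smul, Real.norm_eq_abs, abs_of_nonneg q.1.2.1]
      nlinarith [hgf q.2, q.1.2.1, q.1.2.2, norm_nonneg (g q.2 - f q.2)]
    have h2 := congrArg norm (eq_neg_of_add_eq_zero_left h0)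
    rw [norm_neg, norm_eq_of_mem_sphere] at h2
    linarith
  have hmem : ∀ q, ‖W q‖⁻¹ • W q ∈ Metric.sphere (0 : EuclideanSpace ℝ (Fin (m + 1))) 1 :=
    fun q => by simp [norm_smul, hne q]
  let H : C(I × K, Sph m) := ⟨fun q => ⟨‖W q‖⁻¹ • W q, hmem q⟩,
    Continuous.subtype_mk ((hW.norm.inv₀ fun q => norm_ne_zero_iff.mpr (hne q)).smul hW) hmem⟩
  have hH : ∀ q, (H q : EuclideanSpace ℝ (Fin (m + 1))) = ‖W q‖⁻¹ • W q := fun _ => rfl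
  have hfix : ∀ t x, W (t, x) = f x → H (t, x) = f x := fun t x h => Subtype.ext (by
    rw [hH, h, norm_eq_of_mem_sphere, inv_one, one_smul])
  refine ⟨⟨fun x => H (1, x), by fun_prop⟩, ⟨⟨⟨H, fun x => ?_, fun x => rfl⟩, fun t x hx => ?_⟩⟩,
    fun x => ⟨‖W (1, x)‖⁻¹, ?_⟩⟩
  · exact hfix _ _ (by simp [W])
  · exact hfix _ _ (by simp [W, hA x hx])
  · change (H (1, x) : EuclideanSpace ℝ (Fin (m + 1))) = _
    rw [hH]
    congr 1
    simp [W]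

/-- Maps from a compact subset of a vector space to a sphere of larger dimension are
null-homotopic, relative to any subset on which they are constant. -/
theorem homotopicRel_const [FiniteDimensional ℝ V] [CompactSpace K] (ι : C(K, V)) (hι : Function.Injective ι)
    {m : ℕ} (hm : Module.finrank ℝ V < m) (p : Sph m) (f : C(K, Sph m)) {A : Set K}
    (hA : A.Nonempty) (hf : ∀ x ∈ A, f x = p) :
    f.HomotopicRel (ContinuousMap.const K p) A := by
  obtain ⟨P, hP, hPf, hPp⟩ := exists_smooth_near_rel ι hι
    (⟨fun x => (f x : EuclideanSpace ℝ (Fin (m + 1))), continuous_subtype_val.comp f.continuous⟩ :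
      C(K, EuclideanSpace ℝ (Fin (m + 1)))) p one_pos
  obtain ⟨u, hu⟩ := exists_direction_avoided hm P hP
  obtain ⟨h, hfh, hh⟩ := homotopicRel_of_near f
    ⟨fun x => P (ι x), hP.continuous.comp ι.continuous⟩ hPf (A := A) fun x hx =>
      (hPp x (congrArg Subtype.val (hf x hx))).trans (congrArg Subtype.val (hf x hx)).symm
  refine hfh.trans (homotopicRel_const_of_avoids p h hA (fun x hx => ?_) u fun x hx => ?_)
  · obtain ⟨F⟩ := hfh
    have h1 := F.eq_snd 0 hx
    rw [F.apply_zero] at h1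
    rw [← h1, hf x hx]
  · obtain ⟨c, hc⟩ := hh x
    exact hu (ι x) c (by rw [← hx, hc]; rfl)

/-- The square lies in a plane and `2 < m`, so every double loop contracts relative to the boundary.
-/
theorem pathConnectedSpace_genLoop {m : ℕ} (hm : 2 < m) (p : Sph m) :
    PathConnectedSpace (Ω^ (Fin 2) (Sph m) p) := by
  have key : ∀ f : Ω^ (Fin 2) (Sph m) p, Joined f GenLoop.const := by
    intro f
    obtain ⟨H⟩ := homotopicRel_const (K := Fin 2 → I) (V := Fin 2 → ℝ)
      ⟨fun y i => y i, by fun_prop⟩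
      (fun y z h => funext fun i => Subtype.ext (congrFun h i))
      (by simpa using hm) p f.1 (A := Cube.boundary (Fin 2)) ⟨0, 0, Or.inl rfl⟩ f.2
    refine ⟨⟨⟨fun t => ⟨⟨fun y => H (t, y), by fun_prop⟩, fun y hy => ?_⟩, ?_⟩, ?_, ?_⟩⟩
    · exact (H.eq_fst t hy).trans (f.2 y hy)
    · exact Continuous.subtype_mk (continuous_into_continuousMap H.continuous) _
    · exact Subtype.ext (ContinuousMap.ext fun y => H.apply_zero y)
    · exact Subtype.ext (ContinuousMap.ext fun y => H.apply_one y)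
  exact ⟨⟨GenLoop.const⟩, fun f g => (key f).trans (key g).symm⟩

/-- The interval lies in a line and `1 < m`, so every loop contracts relative to its ends. -/
theorem pathConnectedSpace_pathsInto {m : ℕ} (hm : 1 < m) (p : Sph m) :
    PathConnectedSpace (PathsInto p {p}) := by
  have key : ∀ f : PathsInto p {p}, Joined f (constLoop p) := by
    intro f
    have hf : ∀ x ∈ ({0, 1} : Set I), f.1 x = p := by
      rintro x (rfl | rfl)
      exacts [f.2.1, f.2.2]
    obtain ⟨H⟩ := homotopicRel_const (K := I) (V := ℝ)
      ⟨fun y => y, by fun_prop⟩ Subtype.val_injective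
      (by simpa using hm) p f.1 (A := {0, 1}) ⟨0, Or.inl rfl⟩ hf
    refine ⟨⟨⟨fun t => ⟨⟨fun y => H (t, y), by fun_prop⟩, ?_, ?_⟩, ?_⟩, ?_, ?_⟩⟩
    · exact (H.eq_fst t (Or.inl rfl)).trans (hf 0 (Or.inl rfl))
    · exact (H.eq_fst t (Or.inr rfl)).trans (hf 1 (Or.inr rfl))
    · exact Continuous.subtype_mk (continuous_into_continuousMap H.continuous) _
    · exact Subtype.ext (ContinuousMap.ext fun y => H.apply_zero y)
    · exact Subtype.ext (ContinuousMap.ext fun y => H.apply_one y)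
  exact ⟨⟨constLoop p⟩, fun f g => (key f).trans (key g).symm⟩

end Connectivity

/-! ### Homogeneity of spheres -/

section Spheres

variable {E F : Type*} [NormedAddCommGroup E] [NormedAddCommGroup F]

/-- Linear isometries restrict to unit spheres. -/
def sphereCongr [NormedSpace ℝ E] [NormedSpace ℝ F] (e : E ≃ₗᵢ[ℝ] F) :
    Metric.sphere (0 : E) 1 ≃ₜ Metric.sphere (0 : F) 1 :=
  e.toHomeomorph.subtype fun x => by simp

/-- Unit spheres of inner product spaces are homogeneous. -/
theorem exists_sphere_homeomorph [InnerProductSpace ℝ E] (a b : Metric.sphere (0 : E) 1) :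
    ∃ φ : Metric.sphere (0 : E) 1 ≃ₜ Metric.sphere (0 : E) 1, φ a = b := by
  refine ⟨sphereCongr (Submodule.reflection (ℝ ∙ ((a : E) - b))ᗮ), Subtype.ext ?_⟩
  exact Submodule.reflection_sub (by rw [norm_eq_of_mem_sphere, norm_eq_of_mem_sphere])

/-- The unit sphere of `ℂ^(N+1)` is the sphere of dimension `2N + 1`. -/
theorem exists_USph_homeomorph (N : ℕ) (p : Sph (2 * N + 1)) :
    ∃ φ : USph N ≃ₜ Sph (2 * N + 1), φ (baseU N) = p := by
  have h : Module.finrank ℝ (Vec N) =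
      Module.finrank ℝ (EuclideanSpace ℝ (Fin (2 * N + 1 + 1))) := by
    rw [finrank_real_of_complex, finrank_euclideanSpace_fin, finrank_euclideanSpace_fin]
    omega
  let e : USph N ≃ₜ Sph (2 * N + 1) := sphereCongr
    ((stdOrthonormalBasis ℝ (Vec N)).equiv (stdOrthonormalBasis ℝ _) (finCongr h))
  obtain ⟨φ, hφ⟩ := exists_sphere_homeomorph (e (baseU N)) p
  exact ⟨e.trans φ, hφ⟩

end Spheres

/-! ### Homotopy type of the winding number fibres, and their comparison with the path components -/

section Components

variable {N : ℕ}

theorem nonempty_loops_homeomorph {X Y : Type*} [TopologicalSpace X] [TopologicalSpace Y]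
    (φ : X ≃ₜ Y) (x : X) (y : Y) (h : φ x = y) :
    Nonempty (PathsInto x {x} ≃ₜ Ω Y y) := by
  subst h
  exact ⟨(pathsIntoCongr φ x x).trans (pathHomeomorph _ _).symm⟩

theorem nonempty_doubleLoops_homeomorph {X Y : Type*} [TopologicalSpace X] [TopologicalSpace Y]
    (φ : X ≃ₜ Y) (x : X) (y : Y) (h : φ x = y) :
    Nonempty (PathsInto (constLoop x) {constLoop x} ≃ₜ Ω^ (Fin 2) Y y) := by
  subst h
  exact ⟨(pathsIntoCongr (pathsIntoCongr φ x x) (constLoop x) (constLoop x)).trans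
    (genLoopTwoHomeomorph _).symm⟩

/-- The fibres of the winding number of the boundary loop. -/
def windingFiberHomeomorph (k : ℤ) :
    {γ : RealFiber N // realWinding (boundaryLoop γ) = k} ≃ₜ
      PathsInto (constLoop (baseU N)) (realLoopsWith N k) where
  toFun γ := ⟨γ.1.1, γ.1.2.1, γ.1.2.2, γ.2⟩
  invFun γ := ⟨⟨γ.1, γ.2.1, γ.2.2.choose⟩, γ.2.2.choose_spec⟩
  left_inv γ := rfl
  right_inv γ := rfl
  continuous_toFun := by fun_prop
  continuous_invFun := by fun_prop

/-- The equivariant maps of given degree. -/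
abbrev EquivariantMapsWith (N : ℕ) (k : ℤ) : Type :=
  {f : AllEquivariantMaps N // realWinding (boundaryLoop (equivariantLift f)) = k}

/-- Restricting the lifting equivalence to winding number `k` gives the homotopy fibre over
`realLoopsWith N k`, which splits because its inclusion is null-homotopic. The end point `(-1)^k b`
is moved to `b` along a path in `S^N`, so the result does not depend on `k`. -/
theorem nonempty_equivariantMapsWith_homotopyEquiv (hN : 2 ≤ N) (k : ℤ)
    (p : Sph (2 * N + 1)) (q : Sph N) :
    Nonempty (EquivariantMapsWith N k ≃ₕ (Ω^ (Fin 2) (Sph (2 * N + 1)) p × Ω (Sph N) q)) := by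
  obtain ⟨g, hg, H⟩ := exists_homotopyInverse_equivariantLift (N := N)
  obtain ⟨e₁⟩ := nonempty_homotopyEquiv_fiber equivariantLift g hg H
    (realWinding.comp ⟨boundaryLoop, continuous_boundaryLoop⟩) k
  obtain ⟨e₂⟩ := nonempty_pathsInto_homotopyEquiv (constLoop (baseU N)) (realLoopsWith N k) _
    (homotopic_realLoopsWith (by omega) k)
  have hrank : 1 < Module.rank ℝ (EuclideanSpace ℝ (Fin (N + 1))) := by
    rw [← Module.finrank_eq_rank, finrank_euclideanSpace_fin]
    exact_mod_cast (by omega : 1 < N + 1)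
  have hconn : PathConnectedSpace (Sph N) :=
    isPathConnected_iff_pathConnectedSpace.mp (isPathConnected_sphere hrank 0 zero_le_one)
  obtain ⟨e₃⟩ := nonempty_pathsInto_singleton_homotopyEquiv (baseR N)
    (PathConnectedSpace.joined (endR N k) (baseR N))
  obtain ⟨φ, hφ⟩ := exists_sphere_homeomorph (baseR N) q
  obtain ⟨e₄⟩ := nonempty_loops_homeomorph φ _ _ hφ
  obtain ⟨ψ, hψ⟩ := exists_USph_homeomorph N p
  obtain ⟨e₅⟩ := nonempty_doubleLoops_homeomorph ψ _ _ hψ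
  have e₆ := ((realLoopsWithHomotopyEquiv k).trans e₃).trans e₄.toHomotopyEquiv
  exact ⟨((e₁.trans (windingFiberHomeomorph k).toHomotopyEquiv).trans e₂).trans
    ((e₆.prodCongr e₅.toHomotopyEquiv).trans (Homeomorph.prodComm _ _).toHomotopyEquiv)⟩

theorem pathConnectedSpace_of_homotopyEquiv {X Y : Type*} [TopologicalSpace X]
    [TopologicalSpace Y] (e : X ≃ₕ Y) [PathConnectedSpace Y] : PathConnectedSpace X := by
  obtain ⟨H⟩ := e.left_inv
  have key : ∀ x, Joined (e.invFun (e.toFun x)) x := fun x =>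
    ⟨⟨⟨fun t => H (t, x), by fun_prop⟩, H.apply_zero x, H.apply_one x⟩⟩
  exact ⟨(PathConnectedSpace.nonempty (X := Y)).map e.invFun, fun x y =>
    ((key x).symm.trans ((PathConnectedSpace.joined (e.toFun x) (e.toFun y)).map
      e.invFun.continuous)).trans (key y)⟩

/-- Both loop space factors are path connected because `N ≥ 2`. Hence a winding number fibre lies in
a single path component of `Ω²ℂP^N`. -/
theorem pathConnectedSpace_equivariantMapsWith (hN : 2 ≤ N) (k : ℤ) :
    PathConnectedSpace (EquivariantMapsWith N k) := by
  have p : Sph (2 * N + 1) := ⟨EuclideanSpace.single 0 1, by simp⟩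
  obtain ⟨e⟩ := nonempty_equivariantMapsWith_homotopyEquiv hN k p (baseR N)
  have h₁ := pathConnectedSpace_genLoop (by omega : 2 < 2 * N + 1) p
  have h₂ := pathConnectedSpace_pathsInto (by omega : 1 < N) (baseR N)
  have h₃ : PathConnectedSpace (Ω (Sph N) (baseR N)) :=
    (pathHomeomorph (baseR N) (baseR N)).symm.surjective.pathConnectedSpace
      (pathHomeomorph (baseR N) (baseR N)).symm.continuous
  exact pathConnectedSpace_of_homotopyEquiv e

theorem powerMap_conjS2 (d : ℤ) (x : S2) : powerMap d (conjS2 x) = conjS2 (powerMap d x) := by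
  induction x using OnePoint.rec with
  | infty => rw [conjS2_infty, powerMap_infty, conjS2_infty]
  | coe z =>
    rcases d with (_ | n) | n
    · rfl
    · change ((conj z ^ (n + 1) : ℂ) : S2) = ((conj (z ^ (n + 1)) : ℂ) : S2)
      rw [map_pow]
    · change ((conj (conj z) ^ (n + 1) : ℂ) : S2) = ((conj (conj z ^ (n + 1)) : ℂ) : S2)
      rw [map_pow]

theorem lineMap_conjS2 (hN : 1 ≤ N) (x : S2) :
    lineMap hN (conjS2 x) = conjCP N (lineMap hN x) := by
  induction x using OnePoint.rec with
  | infty => exact conjCP_baseCP.symm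
  | coe z =>
    change (Projectivization.mk ℂ (lineVec N (conj z)) _ : CP N) =
      Projectivization.mk ℂ (conjVec N (lineVec N z)) _
    congr 1
    ext i
    simp only [conjVec_apply, lineVec]
    split_ifs <;> simp

theorem standardMap_conjS2 (hN : 1 ≤ N) (d : ℤ) (x : S2) :
    (standardMap hN d).1 (conjS2 x) = conjCP N ((standardMap hN d).1 x) := by
  change lineMap hN (powerMap d (conjS2 x)) = conjCP N (lineMap hN (powerMap d x))
  rw [powerMap_conjS2, lineMap_conjS2]

/-- On equivariant maps, the degree component is detected by the winding number. -/
theorem mem_degreeComponent_iff (hN : 2 ≤ N) (d : ℤ) (f : AllEquivariantMaps N) :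
    f.1 ∈ degreeComponent (one_le_two.trans hN) d ↔
      realWinding (boundaryLoop (equivariantLift f)) = realWinding (boundaryLoop
        (equivariantLift ⟨standardMap _ d, standardMap_conjS2 (one_le_two.trans hN) d⟩)) := by
  obtain ⟨deg, hdeg⟩ := exists_degree (N := N)
  constructor
  · rintro ⟨γ⟩
    rw [← hdeg, ← hdeg]
    have h := PreconnectedSpace.constant (α := I) (f := fun s => deg (γ s)) inferInstance
      (by fun_prop) (x := 1) (y := 0)
    simpa using h
  -- Equal winding numbers: the path is found already among the equivariant maps, where the fibre of
  -- the winding number is path connected.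
  · intro h
    have := pathConnectedSpace_equivariantMapsWith hN
      (realWinding (boundaryLoop (equivariantLift f)))
    exact (PathConnectedSpace.joined (⟨⟨_, standardMap_conjS2 _ d⟩, h.symm⟩ :
      EquivariantMapsWith N (realWinding (boundaryLoop (equivariantLift f)))) ⟨f, rfl⟩).map
        (continuous_subtype_val.comp continuous_subtype_val)

/-- Equivariant maps in a path component are the equivariant maps of a given winding number. -/
def equivariantMapsHomeomorph (hN : 2 ≤ N) (d : ℤ) :
    EquivariantMaps (N := N) (one_le_two.trans hN) d ≃ₜ
      EquivariantMapsWith N (realWinding (boundaryLoop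
        (equivariantLift ⟨standardMap _ d, standardMap_conjS2 (one_le_two.trans hN) d⟩))) where
  toFun f := ⟨⟨f.1, f.2.2⟩, (mem_degreeComponent_iff hN d ⟨f.1, f.2.2⟩).mp f.2.1⟩
  invFun f := ⟨f.1.1, (mem_degreeComponent_iff hN d f.1).mpr f.2, f.1.2⟩
  left_inv f := rfl
  right_inv f := rfl
  continuous_toFun := by fun_prop
  continuous_invFun := by fun_prop

end Components

end ConjMaps

end

theorem lemma3p3 (N : ℕ) (hN : 2 ≤ N) (d : ℤ)
    (p : ConjMaps.Sph (2 * N + 1)) (q : ConjMaps.Sph N) :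
    Nonempty (ContinuousMap.HomotopyEquiv
      (ConjMaps.EquivariantMaps (N := N) (one_le_two.trans hN) d)
      (Ω^ (Fin 2) (ConjMaps.Sph (2 * N + 1)) p × Ω (ConjMaps.Sph N) q)) := by
  obtain ⟨e⟩ := ConjMaps.nonempty_equivariantMapsWith_homotopyEquiv hN _ p q
  exact ⟨(ConjMaps.equivariantMapsHomeomorph hN d).toHomotopyEquiv.trans e⟩
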